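/- For $p,q\in\mathbb R$ let $v^{p,q}(x)=(1-x)^p(1+x)^q$, $x\in(-1,1)$, and let $c_+=\max\{0,c\}$, $c_-=\max\{0,-c\}$. Let $u=v^{a,b}$ and $w=v^{\alpha,\beta}$ with $a,b,\alpha,\beta>-1$, and put $u_+=v^{a_+,b_+}$, $u_-=v^{a_-,b_-}$ (so $u=u_+/u_-$), $u_1=u_+$, $$u_2(x)=\frac{u_-(x)}{1+(u_+u_-)(-1)\,|\log(1+x)|+(u_+u_-)(1)\,|\log(1-x)|},\qquad -1<x<1 .$$ *Spaces.* For $v=v^{\gamma,\delta}$ with $\gamma,\delta\ge 0$, $C^0_v$ is the space of functions $f$ continuous on $(-1,1)$ such that $fv$ has a finite limit at $1$ and at $-1$, the limit at $1$ being $0$ if $\gamma>0$ and the limit at $-1$ being $0$ if $\delta>0$; its norm is $\|fv\|_\infty=\sup_{(-1,1)}|f|v$. Let $E_n(f)_v=\inf\|(f-P)v\|_\infty$ over all polynomials $P$ of degree at most $n$, and let $B_0(v)$ be the set of all $f\in C^0_v$ such that $\sum_{n\ge1}\frac{E_n(f)_v}{n+1}<\infty$, with norm $\|f\|_{B_0(v)}=\|fv\|_\infty+\sum_{n\ge1}\frac{E_n(f)_v}{n+1}$.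 *VP polynomial.* Let $p_j(w)$ be the orthonormal polynomials (with positive leading coefficients) of the weight $w$ on $[-1,1]$, let $x_1,\dots,x_n$ be the zeros of $p_n(w)$, and let $\lambda_k=\big(\sum_{j=0}^{n-1}p_j(w,x_k)^2\big)^{-1}$. For integers $0<m<n$ put $\mu_{n,j}^m=1$ if $0\le j\le n-m$, $\mu_{n,j}^m=\frac{n+m-j}{2m}$ if $n-m<j<n+m$, and $$V_n^m(w,f,x)=\sum_{k=1}^n f(x_k)\,\lambda_k\sum_{j=0}^{n+m-1}\mu_{n,j}^m\,p_j(w,x_k)\,p_j(w,x).$$ *Quadrature error.* Let $\mathcal H^uf(t)=\lim_{\epsilon\to0+}\int_{\{x\in(-1,1):\,|x-t|\ge\epsilon\}}\frac{f(x)}{x-t}u(x)\,dx$ for $-1<t<1$, let $\mathcal H^u_{n,m}(w,f,t)=\mathcal H^u[V_n^m(w,f)](t)$ be the VP rule, and let ${\mathcal E}^u_{n,m}(w,f,t)=|\mathcal H^uf(t)-\mathcal H^u_{n,m}(w,f,t)|$. **Theorem.** (i) There is a constant $C>0$, independent of $n,m,f,t$, such that for all $f\in B_0(u_1)$, all integers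 $0<m<n$ and all $t\in(-1,1)$, the principal values $\mathcal H^uf(t)$ and $\mathcal H^u_{n,m}(w,f,t)$ exist, $f-V_n^m(w,f)\in B_0(u_1)$, and $${\mathcal E}^u_{n,m}(w,f,t)\,u_2(t)\le C\,|f(t)-V_n^m(w,f,t)|\,u_1(t)+C\,\|f-V_n^m(w,f)\|_{B_0(u_1)} .$$ (ii) Let $c_2\ge c_1>1$, and write $m\approx n$ if $m,n$ are positive integers with $c_1m\le n\le c_2m$. If the maps $V_n^m(w):C^0_{u_1}\to C^0_{u_1}$ are uniformly bounded with respect to all $m\approx n$, i.e. there is $K>0$ with $\|V_n^m(w,f)u_1\|_\infty\le K\|fu_1\|_\infty$ for all $f\in C^0_{u_1}$ and all $m\approx n$, then for every $f\in B_0(u_1)$ $$\lim_{n\to\infty,\ m\approx n}{\mathcal E}^u_{n,m}(w,f,t)\,u_2(t)=0$$ uniformly in $t\in(-1,1)$; that is, for every $\varepsilon>0$ there is $N$ such that ${\mathcal E}^u_{n,m}(w,f,t)u_2(t)<\varepsilon$ for all $n\ge N$, all $m\approx n$ and all $t\in(-1,1)$. -/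

import Mathlib

open Set Filter Topology MeasureTheory Polynomial
open scoped ENNReal

noncomputable section

namespace VPHilbert

/-- The Jacobi weight `v^{a,b}(x) = (1 - x)^a (1 + x)^b`. -/
def jacobi (a b x : ℝ) : ℝ := (1 - x) ^ a * (1 + x) ^ b

/-- The positive part `c_+ = max {0, c}`. -/
def plusPart (c : ℝ) : ℝ := max 0 c

/-- The negative part `c_- = max {0, -c}`. -/
def minusPart (c : ℝ) : ℝ := max 0 (-c)

/-- `u_+ = v^{a_+,b_+}` for `u = v^{a,b}`. -/
def uPlus (a b x : ℝ) : ℝ := jacobi (plusPart a) (plusPart b) x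

/-- `u_- = v^{a_-,b_-}` for `u = v^{a,b}`. -/
def uMinus (a b x : ℝ) : ℝ := jacobi (minusPart a) (minusPart b) x

/-- `u_1 = u_+`. -/
def u₁ (a b x : ℝ) : ℝ := uPlus a b x

/-- `u_2 = u_- / (1 + (u_+u_-)(-1) |log (1 + x)| + (u_+u_-)(1) |log (1 - x)|)`. -/
def u₂ (a b x : ℝ) : ℝ :=
  uMinus a b x /
    (1 + uPlus a b (-1) * uMinus a b (-1) * |Real.log (1 + x)|
      + uPlus a b 1 * uMinus a b 1 * |Real.log (1 - x)|)

/-! ### Weighted continuous functions, best approximation, the space `B₀` -/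

/-- `‖f v‖_∞`, the supremum of `|f| v` over `(-1, 1)` for `v = v^{γ,δ}`, as an extended number. -/
def wSupNorm (γ δ : ℝ) (f : ℝ → ℝ) : ℝ≥0∞ :=
  ⨆ x ∈ Ioo (-1 : ℝ) 1, ENNReal.ofReal (|f x| * jacobi γ δ x)

/-- The space `C⁰_v`, `v = v^{γ,δ}`: `f` is continuous on `(-1, 1)`, and `f v` has limits at `±1`,
which vanish at an endpoint where the weight has a positive exponent.
Only the values of `f` on `(-1, 1)` matter. -/
def MemC0 (γ δ : ℝ) (f : ℝ → ℝ) : Prop :=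
  ContinuousOn f (Ioo (-1) 1) ∧
  (∃ l : ℝ, Tendsto (fun x => f x * jacobi γ δ x) (𝓝[<] 1) (𝓝 l) ∧ (0 < γ → l = 0)) ∧
  (∃ l : ℝ, Tendsto (fun x => f x * jacobi γ δ x) (𝓝[>] (-1)) (𝓝 l) ∧ (0 < δ → l = 0))

/-- `E_n(f)_v`, the error of best approximation of `f` by polynomials of degree at most `n`. -/
def bestApprox (γ δ : ℝ) (n : ℕ) (f : ℝ → ℝ) : ℝ≥0∞ :=
  ⨅ (P : ℝ[X]) (_ : P.natDegree ≤ n), wSupNorm γ δ (fun x => f x - P.eval x)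

/-- `∑_{n ≥ 1} E_n(f)_v / (n + 1)`. -/
def besovSum (γ δ : ℝ) (f : ℝ → ℝ) : ℝ≥0∞ :=
  ∑' n : ℕ, bestApprox γ δ (n + 1) f / ((n : ℝ≥0∞) + 2)

/-- The space `B₀(v)`, `v = v^{γ,δ}`. -/
def MemB0 (γ δ : ℝ) (f : ℝ → ℝ) : Prop := MemC0 γ δ f ∧ besovSum γ δ f < ∞

/-- The norm of `B₀(v)`: `‖f v‖_∞ + ∑_{n ≥ 1} E_n(f)_v / (n + 1)`. It is a finite sum for
`f ∈ B₀(v)`. -/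
def normB0 (γ δ : ℝ) (f : ℝ → ℝ) : ℝ := (wSupNorm γ δ f + besovSum γ δ f).toReal

/-! ### The finite Hilbert transform -/

/-- The truncated integral `∫_{|x - t| ≥ ε} f(x) / (x - t) u(x) dx` over `[-1, 1]`,
for `u = v^{a,b}`. -/
def truncHilbert (a b : ℝ) (f : ℝ → ℝ) (t ε : ℝ) : ℝ :=
  ∫ x in Ioo (-1 : ℝ) 1 ∩ {x | ε ≤ |x - t|}, f x / (x - t) * jacobi a b x

/-- `ℋᵘf(t)` exists as a Cauchy principal value: the truncated integrals converge absolutely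
and have a finite limit as `ε → 0+`. -/
def HilbertExists (a b : ℝ) (f : ℝ → ℝ) (t : ℝ) : Prop :=
  (∀ ε > 0, IntegrableOn (fun x => f x / (x - t) * jacobi a b x)
    (Ioo (-1 : ℝ) 1 ∩ {x | ε ≤ |x - t|})) ∧
  ∃ I : ℝ, Tendsto (truncHilbert a b f t) (𝓝[>] 0) (𝓝 I)

/-- The finite Hilbert transform `ℋᵘf(t)`, `u = v^{a,b}` (meaningful if `HilbertExists a b f t`). -/
def hilbert (a b : ℝ) (f : ℝ → ℝ) (t : ℝ) : ℝ :=
  limUnder (𝓝[>] (0 : ℝ)) (truncHilbert a b f t)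

/-! ### Jacobi polynomials and the filtered de la Vallée Poussin polynomial -/

/-- The inner product `∫_{-1}^1 P Q w`, `w = v^{α,β}`. -/
def wInner (α β : ℝ) (P Q : ℝ[X]) : ℝ :=
  ∫ x in Ioo (-1 : ℝ) 1, P.eval x * Q.eval x * jacobi α β x

/-- The monic orthogonal polynomials of `w = v^{α,β}`, by the Gram-Schmidt process. -/
def monicOrth (α β : ℝ) : ℕ → ℝ[X]
  | n => X ^ n - ∑ k : Fin n,
      C (wInner α β (X ^ n) (monicOrth α β k) /
        wInner α β (monicOrth α β k) (monicOrth α β k)) * monicOrth α β k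
  termination_by n => n
  decreasing_by all_goals exact k.2

/-- The `n`-th orthonormal polynomial `p_n(w)` of `w = v^{α,β}`, with positive leading
coefficient. -/
def orthoPoly (α β : ℝ) (n : ℕ) : ℝ[X] :=
  C (Real.sqrt (wInner α β (monicOrth α β n) (monicOrth α β n)))⁻¹ * monicOrth α β n

/-- The set of nodes `X_n(w)`: the zeros of `p_n(w)`. -/
def nodes (α β : ℝ) (n : ℕ) : Finset ℝ := (orthoPoly α β n).roots.toFinset

/-- The Christoffel number `λ_{n,k}(w)` belonging to the node `y = x_k`. -/
def christoffel (α β : ℝ) (n : ℕ) (y : ℝ) : ℝ :=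
  (∑ j ∈ Finset.range n, ((orthoPoly α β j).eval y) ^ 2)⁻¹

/-- The VP filter coefficients `μ_{n,j}^m`, for `0 ≤ j < n + m`. -/
def vpFilter (n m j : ℕ) : ℝ :=
  if j + m ≤ n then 1 else ((n : ℝ) + m - j) / (2 * m)

/-- The fundamental VP polynomial `Φ_{n,k}^m` belonging to the node `y = x_k`. -/
def vpFundamental (α β : ℝ) (n m : ℕ) (y : ℝ) : ℝ[X] :=
  C (christoffel α β n y) * ∑ j ∈ Finset.range (n + m),
    C (vpFilter n m j * (orthoPoly α β j).eval y) * orthoPoly α β j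

/-- The filtered VP polynomial `V_n^m(w, f) = ∑_k f(x_k) Φ_{n,k}^m`, `w = v^{α,β}`. -/
def vp (α β : ℝ) (n m : ℕ) (f : ℝ → ℝ) : ℝ[X] :=
  ∑ y ∈ nodes α β n, C (f y) * vpFundamental α β n m y

/-- The VP quadrature rule `ℋ_{n,m}^u(w, f, t)`: the Hilbert transform of `V_n^m(w, f)`. -/
def vpRule (a b α β : ℝ) (n m : ℕ) (f : ℝ → ℝ) (t : ℝ) : ℝ :=
  hilbert a b (fun x => (vp α β n m f).eval x) t

/-- The error `ℰ_{n,m}^u(w, f, t) = |ℋᵘf(t) - ℋ_{n,m}^u(w, f, t)|`. -/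
def vpError (a b α β : ℝ) (n m : ℕ) (f : ℝ → ℝ) (t : ℝ) : ℝ :=
  |hilbert a b f t - vpRule a b α β n m f t|

/-- The relation `m ≈ n` with constants `c₁, c₂`, for positive integers `m, n`. -/
def Comparable (c₁ c₂ : ℝ) (n m : ℕ) : Prop := 0 < m ∧ c₁ * m ≤ n ∧ (n : ℝ) ≤ c₂ * m

/-- The maps `V_n^m(w) : C⁰_v → C⁰_v`, `w = v^{α,β}`, `v = v^{γ,δ}`, are uniformly bounded
with respect to all `m ≈ n` (with constants `c₁, c₂`). -/
def VPUniformlyBounded (α β γ δ c₁ c₂ : ℝ) : Prop :=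
  ∃ K : ℝ, 0 < K ∧ ∀ n m : ℕ, Comparable c₁ c₂ n m → ∀ f : ℝ → ℝ, MemC0 γ δ f →
    wSupNorm γ δ (fun x => (vp α β n m f).eval x) ≤ ENNReal.ofReal K * wSupNorm γ δ f

end VPHilbert

end

open VPHilbert

/-!
The estimate behind both parts is that for `F ∈ B₀(u₊)` and `-1 < t < 1` the principal value
`ℋF(t)` exists and `|ℋF(t)| u₂(t) ≤ C ‖F‖_{B₀(u₊)}` (`exists_hilbert_le`). Part (i) is this bound
for `F = f - V_n^m f`, which belongs to `B₀(u₊)` because polynomials do; the pointwise term on the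
right of (i) is not needed, as it is itself dominated by the norm.

*The estimate.* Subtracting `F(t) u(t)` from `F u` on the interval `|x - t| < (1 - |t|) / 2`,
which is symmetric about `t`, does not change principal values, so `ℋF(t)` is the integral of the
function `regKernel a b F t` as soon as the latter is integrable (`hilbertExists_of_integrable`).
The absolute integral of this function is countably subadditive in `F`, and for a polynomial `Q`
of degree `N` it is at most `C (1 + log N) ‖Q u₊‖_∞ / u₂(t)`
(`exists_lintegral_regKernel_polynomial_le`): near `t` the Markov inequality makes `Q u` Lipschitz
with a constant that is a power of `N`, near an endpoint where `u₊` vanishes `Q` grows at most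
like a power of `N`, and each power of `N` costs a logarithm after integration against
`dx / |x - t|`. At the endpoints where `u₊` does not vanish, the integral of `1 / u₋` against `dx / |x - t|`
is what `u₂` compensates for. Finally `F` is the sum of differences of nearly best approximations
of degree `N_j = 2^{2^j}`, for which `log N_j ≈ 2^j`, and `∑_j 2^j E_{N_j}(F)` is bounded by
`∑_n E_n(F) / (n + 1)` by applying Cauchy condensation twice (`tsum_two_pow_mul_bestApprox_le`).

*Convergence.* For part (ii) it remains to see that `f - V_n^m f` tends to `0` in `B₀(u₊)`. By
Gauss quadrature, `V_n^m` reproduces polynomials of degree at most `n - m` (`vp_polynomial`), so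
uniform boundedness gives `‖(f - V_n^m f) u₊‖_∞ ≤ (1 + K) E_{n-m}(f)`; since `n - m` and `n + m`
are comparable, this and `E_j(f - V_n^m f) = E_j(f)` for `j ≥ n + m` yield a summable majorant
(`norm_sub_vp_le`), and dominated convergence applies. Quadrature needs that `p_n` has `n`
distinct real zeros (`card_nodes`); their position in `(-1, 1)` plays no role.
-/

namespace VPHilbert

/-! ### Polynomial inequalities -/

/-- The Markov inequality at an endpoint, from the extremal property of Chebyshev polynomials. -/
theorem abs_derivative_right_le {P : ℝ[X]} {N : ℕ} (hN : P.natDegree ≤ N) {l r M : ℝ}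
    (hlr : l < r) (h : ∀ x ∈ Icc l r, |P.eval x| ≤ M) :
    |P.derivative.eval r| ≤ 2 * N ^ 2 * M / (r - l) := by
  have hM : 0 ≤ M := (abs_nonneg _).trans (h l ⟨le_rfl, hlr.le⟩)
  rcases hM.eq_or_lt with rfl | hM
  · have : P = 0 := by
      apply Polynomial.eq_zero_of_infinite_isRoot
      refine (Icc_infinite hlr).mono fun x hx => ?_
      simpa using abs_nonpos_iff.1 (h x hx)
    simp [this]
  have key : ∀ s : ℝ, |s| = 1 → s * P.derivative.eval r ≤ 2 * N ^ 2 * M / (r - l) := by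
    intro s hs
    have h1 := Chebyshev.eval_iterate_derivative_le_of_forall_abs_le_one (n := N) (k := 1)
      (x := 1) (P := C (s * M⁻¹) * P.comp (C ((r + l) / 2) + C ((r - l) / 2) * X)) le_rfl ?_ ?_
    · have h2 : (derivative (Chebyshev.T ℝ N)).eval 1 = (N : ℝ) ^ 2 := by
        simp [Chebyshev.T_derivative_eq_U]; ring
      simp only [Function.iterate_one] at h1
      rw [h2] at h1
      have e : (r + l) / 2 + (r - l) / 2 = r := by ring
      simp [derivative_comp, e] at h1
      rw [le_div_iff₀ (by linarith)]
      have := mul_le_mul_of_nonneg_left h1 (by positivity : 0 ≤ 2 * M)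
      calc s * eval r (derivative P) * (r - l)
          = 2 * M * (s * M⁻¹ * ((r - l) / 2 * eval r (derivative P))) := by field_simp
        _ ≤ _ := by linarith
    · refine natDegree_le_iff_degree_le.1 ((natDegree_C_mul_le _ _).trans ?_)
      refine natDegree_comp_le.trans ?_
      have : (C ((r + l) / 2) + C ((r - l) / 2) * X : ℝ[X]).natDegree ≤ 1 := by
        compute_degree
      nlinarith
    · intro x hx
      have hy : (r + l) / 2 + (r - l) / 2 * x ∈ Icc l r := by
        constructor <;> nlinarith [hx.1, hx.2]
      have := h _ hy
      simp [abs_mul, hs, abs_of_pos hM]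
      rw [inv_mul_le_iff₀ hM]; linarith
  rw [abs_le]
  constructor
  · have := key (-1) (by simp); linarith
  · have := key 1 (by simp); linarith

theorem abs_derivative_left_le {P : ℝ[X]} {N : ℕ} (hN : P.natDegree ≤ N) {l r M : ℝ}
    (hlr : l < r) (h : ∀ x ∈ Icc l r, |P.eval x| ≤ M) :
    |P.derivative.eval l| ≤ 2 * N ^ 2 * M / (r - l) := by
  have := abs_derivative_right_le (P := P.comp (C (l + r) - X)) (N := N) (l := l) (r := r) (M := M)
    ?_ hlr ?_
  · simpa [derivative_comp] using this
  · refine natDegree_comp_le.trans ?_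
    have : (C (l + r) - X : ℝ[X]).natDegree ≤ 1 := by compute_degree
    nlinarith
  · intro x hx
    simpa using h (l + r - x) ⟨by linarith [hx.2], by linarith [hx.1]⟩

/-- A Markov inequality on an interval (with the constant `4` instead of the sharp `2`): the
derivative at an interior point is an endpoint derivative for the longer of the two halves. -/
theorem abs_derivative_le {P : ℝ[X]} {N : ℕ} (hN : P.natDegree ≤ N) {l r M : ℝ}
    (hlr : l < r) (h : ∀ x ∈ Icc l r, |P.eval x| ≤ M) {x : ℝ} (hx : x ∈ Icc l r) :
    |P.derivative.eval x| ≤ 4 * N ^ 2 * M / (r - l) := by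
  have hM : 0 ≤ M := (abs_nonneg _).trans (h l ⟨le_rfl, hlr.le⟩)
  have hc : 4 * N ^ 2 * M / (r - l) = 2 * N ^ 2 * M / ((r - l) / 2) := by
    field_simp; ring
  rw [hc]
  rcases le_total ((l + r) / 2) x with h' | h'
  · refine (abs_derivative_right_le hN (l := l) (M := M) (by linarith)
      fun y hy => h y ⟨hy.1, hy.2.trans hx.2⟩).trans ?_
    gcongr
    linarith
  · refine (abs_derivative_left_le hN (r := r) (M := M) (by linarith)
      fun y hy => h y ⟨hx.1.trans hy.1, hy.2⟩).trans ?_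
    gcongr
    linarith

/-- A polynomial of degree `N` with `|Q(x)| (1 - x)^A ≤ M` on `[0, 1)` grows at most like `N^{2A}`
at `1`: by the Markov inequality it is comparable to its maximum on an interval of length
`N^{-2}`, hence at some point at distance `N^{-2}` from `1`. -/
theorem abs_eval_le_of_weighted {Q : ℝ[X]} {N : ℕ} (hN : Q.natDegree ≤ N) (hN1 : 1 ≤ N) {A M : ℝ}
    (hA : 0 ≤ A) (h : ∀ x ∈ Ico (0 : ℝ) 1, |Q.eval x| * (1 - x) ^ A ≤ M) {x : ℝ}
    (hx : x ∈ Icc (0 : ℝ) 1) : |Q.eval x| ≤ 2 * M * (8 * (N : ℝ) ^ 2) ^ A := by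
  obtain ⟨ξ, hξ, hmax⟩ := isCompact_Icc.exists_isMaxOn (nonempty_Icc.2 (zero_le_one (α := ℝ)))
    (Q.continuous.abs.continuousOn)
  refine (hmax hx).trans ?_
  have hN0 : (1 : ℝ) ≤ N := by exact_mod_cast hN1
  set δ : ℝ := 1 / (8 * (N : ℝ) ^ 2) with hδ
  have hδ0 : 0 < δ := by positivity
  have hδ1 : δ ≤ 1 / 8 := by
    rw [hδ]; gcongr; nlinarith
  obtain ⟨y, hy0, hy1, hyξ⟩ : ∃ y : ℝ, 0 ≤ y ∧ δ ≤ 1 - y ∧ |ξ - y| ≤ δ := by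
    refine ⟨min ξ (1 - δ), le_min hξ.1 (by linarith), by linarith [min_le_right ξ (1 - δ)], ?_⟩
    rw [abs_le]
    rcases min_cases ξ (1 - δ) with ⟨e, h⟩ | ⟨e, h⟩ <;> rw [e] <;> constructor <;>
      linarith [hξ.2]
  have hder : ∀ z ∈ Icc (0 : ℝ) 1, ‖(derivative Q).eval z‖ ≤ 4 * N ^ 2 * |Q.eval ξ| := by
    intro z hz
    have := abs_derivative_le hN zero_lt_one (fun w hw => hmax hw) hz
    simpa using this
  have hmv := (convex_Icc (0 : ℝ) 1).norm_image_sub_le_of_norm_hasDerivWithin_le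
    (fun z _ => (Q.hasDerivAt z).hasDerivWithinAt) hder (x := y) (y := ξ)
    ⟨hy0, by linarith⟩ hξ
  rw [Real.norm_eq_abs, Real.norm_eq_abs] at hmv
  have h2 : 4 * N ^ 2 * |Q.eval ξ| * |ξ - y| ≤ |Q.eval ξ| / 2 := by
    calc 4 * N ^ 2 * |Q.eval ξ| * |ξ - y| ≤ 4 * N ^ 2 * |Q.eval ξ| * δ := by gcongr
      _ = _ := by rw [hδ]; field_simp; ring
  have h3 : |Q.eval ξ| ≤ 2 * |Q.eval y| := by
    have := abs_sub_abs_le_abs_sub (Q.eval ξ) (Q.eval y)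
    linarith
  have hy := h y ⟨hy0, by linarith⟩
  have h4 : |Q.eval y| ≤ M * (8 * (N : ℝ) ^ 2) ^ A := by
    have h5 : δ ^ A ≤ (1 - y) ^ A := Real.rpow_le_rpow hδ0.le hy1 hA
    have h6 : |Q.eval y| * δ ^ A ≤ M := (by gcongr : _ ≤ _).trans hy
    have h7 : δ ^ A * (8 * (N : ℝ) ^ 2) ^ A = 1 := by
      rw [← Real.mul_rpow hδ0.le (by positivity), hδ, one_div,
        inv_mul_cancel₀ (by positivity), Real.one_rpow]
    calc |Q.eval y| = |Q.eval y| * δ ^ A * (8 * (N : ℝ) ^ 2) ^ A := by rw [mul_assoc, h7, mul_one]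
      _ ≤ _ := by gcongr
  linarith

/-! ### Principal values -/

/-- The regularized Hilbert kernel applied to `F`: the integrand `F(x) u(x) / (x - t)`, with the
value `F(t) u(t)` subtracted from the numerator on the interval `|x - t| < (1 - |t|) / 2`. This
interval lies in `(-1, 1)` and is symmetric about `t`, so the subtraction does not change principal
values. -/
noncomputable def regKernel (a b : ℝ) (F : ℝ → ℝ) (t x : ℝ) : ℝ :=
  (F x * jacobi a b x - if |x - t| < (1 - |t|) / 2 then F t * jacobi a b t else 0) / (x - t)

theorem setIntegral_symm_eq_zero {t d c ε : ℝ} (hd : Ioo (t - d) (t + d) ⊆ Ioo (-1) 1) :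
    ∫ x in Ioo (-1 : ℝ) 1 ∩ {x | ε ≤ |x - t|}, (if |x - t| < d then c else 0) / (x - t) = 0 := by
  have hS : MeasurableSet (Ioo (-1 : ℝ) 1 ∩ {x | ε ≤ |x - t|}) :=
    measurableSet_Ioo.inter (measurableSet_le measurable_const (by fun_prop))
  rw [← integral_indicator hS]
  set h : ℝ → ℝ := (Ioo (-1 : ℝ) 1 ∩ {x | ε ≤ |x - t|}).indicator
    fun x => (if |x - t| < d then c else 0) / (x - t) with hh
  have hh' : ∀ x, h x = if ε ≤ |x - t| ∧ |x - t| < d then c / (x - t) else 0 := by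
    intro x
    by_cases h1 : |x - t| < d
    · have : x ∈ Ioo (-1 : ℝ) 1 := hd ⟨by linarith [(abs_lt.1 h1).1], by linarith [(abs_lt.1 h1).2]⟩
      simp [hh, indicator_apply, h1, this.1, this.2]
    · simp [hh, indicator_apply, h1]
  have hodd : ∀ x, h (2 * t - x) = - h x := by
    intro x
    have e : 2 * t - x - t = -(x - t) := by ring
    rw [hh', hh', e, abs_neg]
    split_ifs
    · rw [div_neg]
    · simp
  have h1 := integral_sub_left_eq_self h volume (2 * t)
  simp only [hodd, integral_neg] at h1
  linarith

theorem nearInterval_subset {t : ℝ} (ht : t ∈ Ioo (-1 : ℝ) 1) :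
    Ioo (t - (1 - |t|) / 2) (t + (1 - |t|) / 2) ⊆ Ioo (-1) 1 := by
  have := abs_lt.2 ht
  have h1 := le_abs_self t
  have h2 := neg_abs_le t
  intro x hx
  constructor <;> linarith [hx.1, hx.2]

/-- If the regularized kernel is integrable, then the principal value exists and equals its
integral. -/
theorem hilbertExists_of_integrable {a b t : ℝ} (ht : t ∈ Ioo (-1 : ℝ) 1) {F : ℝ → ℝ}
    (hF : IntegrableOn (regKernel a b F t) (Ioo (-1) 1)) :
    HilbertExists a b F t ∧
      hilbert a b F t = ∫ x in Ioo (-1 : ℝ) 1, regKernel a b F t x := by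
  set d := (1 - |t|) / 2 with hd
  set c := F t * jacobi a b t with hc
  set k : ℝ → ℝ := fun x => (if |x - t| < d then c else 0) / (x - t) with hk
  have hsplit : ∀ x, F x / (x - t) * jacobi a b x = regKernel a b F t x + k x := by
    intro x
    simp only [regKernel, hk, ← hd, ← hc]
    rw [← add_div]; ring
  have hS : ∀ ε : ℝ, MeasurableSet (Ioo (-1 : ℝ) 1 ∩ {x | ε ≤ |x - t|}) := fun ε =>
    measurableSet_Ioo.inter (measurableSet_le measurable_const (by fun_prop))
  have hψ : ∀ ε : ℝ, IntegrableOn (regKernel a b F t) (Ioo (-1 : ℝ) 1 ∩ {x | ε ≤ |x - t|}) :=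
    fun ε => hF.mono_set inter_subset_left
  have hki : ∀ ε > 0, IntegrableOn k (Ioo (-1 : ℝ) 1 ∩ {x | ε ≤ |x - t|}) := by
    intro ε hε
    have hkm : Measurable k := by
      refine Measurable.div (Measurable.ite ?_ measurable_const measurable_const) (by fun_prop)
      exact measurableSet_lt (by fun_prop) measurable_const
    refine IntegrableOn.of_bound (C := |c| / ε) ?_ hkm.aestronglyMeasurable ?_
    · exact (measure_mono inter_subset_left).trans_lt (by simp)
    · filter_upwards [ae_restrict_mem (hS ε)] with x hx
      have hx2 : ε ≤ |x - t| := hx.2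
      simp only [hk, norm_div, Real.norm_eq_abs]
      refine div_le_div₀ (abs_nonneg c) ?_ hε hx2
      by_cases h : |x - t| < d <;> simp [h]
  have htr : ∀ ε > 0, truncHilbert a b F t ε =
      ∫ x in Ioo (-1 : ℝ) 1 ∩ {x | ε ≤ |x - t|}, regKernel a b F t x := by
    intro ε hε
    simp only [truncHilbert, hsplit]
    rw [integral_add (hψ ε) (hki ε hε), setIntegral_symm_eq_zero (nearInterval_subset ht), add_zero]
  have hlim : Tendsto (truncHilbert a b F t) (𝓝[>] 0)
      (𝓝 (∫ x in Ioo (-1 : ℝ) 1, regKernel a b F t x)) := by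
    have h1 : Tendsto (fun ε : ℝ => ∫ x in Ioo (-1 : ℝ) 1,
        ({x | ε ≤ |x - t|} : Set ℝ).indicator (regKernel a b F t) x) (𝓝[>] 0)
        (𝓝 (∫ x in Ioo (-1 : ℝ) 1, regKernel a b F t x)) := by
      refine tendsto_integral_filter_of_dominated_convergence
        (fun x => ‖regKernel a b F t x‖) ?_ ?_ hF.norm ?_
      · exact Eventually.of_forall fun ε => hF.aestronglyMeasurable.indicator
          (measurableSet_le measurable_const (by fun_prop))
      · exact Eventually.of_forall fun ε => Eventually.of_forall fun x =>
          norm_indicator_le_norm_self _ _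
      · refine Eventually.of_forall fun x => ?_
        rcases eq_or_ne x t with rfl | hx
        · -- at `x = t` the kernel is `0 / 0 = 0`
          have : regKernel a b F x x = 0 := by simp [regKernel]
          refine tendsto_const_nhds.congr fun ε => ?_
          rw [indicator_apply, this, ite_self]
        · have h0 : 0 < |x - t| := abs_pos.2 (sub_ne_zero.2 hx)
          refine tendsto_const_nhds.congr' ?_
          filter_upwards [Ioc_mem_nhdsGT h0] with ε hε
          rw [indicator_of_mem]
          exact hε.2
    refine h1.congr' ?_
    filter_upwards [self_mem_nhdsWithin] with ε hε
    rw [htr ε hε, setIntegral_indicator (measurableSet_le measurable_const (by fun_prop))]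
  refine ⟨⟨fun ε hε => ?_, _, hlim⟩, hlim.limUnder_eq⟩
  simp only [hsplit]
  exact (hψ ε).add (hki ε hε)

theorem hilbert_sub {a b t : ℝ} {f g : ℝ → ℝ} (hf : HilbertExists a b f t)
    (hg : HilbertExists a b g t) :
    hilbert a b (fun x => f x - g x) t = hilbert a b f t - hilbert a b g t := by
  obtain ⟨hf1, I, hI⟩ := hf
  obtain ⟨hg1, J, hJ⟩ := hg
  rw [hilbert, hilbert, hilbert, hI.limUnder_eq, hJ.limUnder_eq]
  refine Tendsto.limUnder_eq ((hI.sub hJ).congr' ?_)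
  filter_upwards [self_mem_nhdsWithin] with ε hε
  simp only [truncHilbert]
  rw [← integral_sub (hf1 ε hε) (hg1 ε hε)]
  congr 1
  ext x
  ring

/-! ### Jacobi weights -/

theorem jacobi_pos (a b : ℝ) {x : ℝ} (hx : x ∈ Ioo (-1 : ℝ) 1) : 0 < jacobi a b x :=
  mul_pos (Real.rpow_pos_of_pos (by linarith [hx.2]) _)
    (Real.rpow_pos_of_pos (by linarith [hx.1]) _)

theorem jacobi_mul_jacobi (a b c d : ℝ) {x : ℝ} (hx : x ∈ Ioo (-1 : ℝ) 1) :
    jacobi a b x * jacobi c d x = jacobi (a + c) (b + d) x := by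
  have h1 : 0 < 1 - x := by linarith [hx.2]
  have h2 : 0 < 1 + x := by linarith [hx.1]
  simp only [jacobi, Real.rpow_add h1, Real.rpow_add h2]
  ring

theorem plusPart_nonneg (c : ℝ) : 0 ≤ plusPart c := le_max_left _ _

theorem minusPart_nonneg (c : ℝ) : 0 ≤ minusPart c := le_max_left _ _

theorem add_minusPart (c : ℝ) : c + minusPart c = plusPart c := by
  rcases le_total c 0 with h | h
  · rw [minusPart, plusPart, max_eq_right (by linarith), max_eq_left h]; ring
  · rw [minusPart, plusPart, max_eq_left (by linarith), max_eq_right h]; ring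

theorem uMinus_pos (a b : ℝ) {x : ℝ} (hx : x ∈ Ioo (-1 : ℝ) 1) : 0 < uMinus a b x :=
  jacobi_pos _ _ hx

theorem jacobi_mul_uMinus (a b : ℝ) {x : ℝ} (hx : x ∈ Ioo (-1 : ℝ) 1) :
    jacobi a b x * uMinus a b x = jacobi (plusPart a) (plusPart b) x := by
  rw [uMinus, jacobi_mul_jacobi _ _ _ _ hx, add_minusPart, add_minusPart]

theorem rpow_le_two_rpow_mul {x y : ℝ} (p : ℝ) (hx : 0 < x) (hy : 0 < y) (h1 : x ≤ 2 * y)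
    (h2 : y ≤ 2 * x) : x ^ p ≤ 2 ^ |p| * y ^ p := by
  rcases le_total 0 p with hp | hp
  · rw [abs_of_nonneg hp, ← Real.mul_rpow (by norm_num) hy.le]
    exact Real.rpow_le_rpow hx.le h1 hp
  · rw [abs_of_nonpos hp]
    have h3 : (2 * x) ^ p ≤ y ^ p := Real.rpow_le_rpow_of_nonpos hy h2 hp
    rw [Real.mul_rpow (by norm_num) hx.le] at h3
    have h4 : (2 : ℝ) ^ (-p) * 2 ^ p = 1 := by
      rw [← Real.rpow_add (by norm_num)]; simp
    calc x ^ p = 2 ^ (-p) * (2 ^ p * x ^ p) := by rw [← mul_assoc, h4, one_mul]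
      _ ≤ _ := by gcongr

/-- On the interval `|x - t| ≤ (1 - |t|) / 2` a Jacobi weight is comparable to its value at `t`. -/
theorem jacobi_le_mul_jacobi (a b : ℝ) {t x : ℝ} (ht : t ∈ Ioo (-1 : ℝ) 1)
    (hx : |x - t| ≤ (1 - |t|) / 2) : jacobi a b x ≤ 2 ^ (|a| + |b|) * jacobi a b t := by
  have h0 := abs_lt.2 ht
  have h1 := le_abs_self t
  have h2 := neg_abs_le t
  have h3 := abs_le.1 hx
  have e1 := rpow_le_two_rpow_mul (x := 1 - x) (y := 1 - t) a (by linarith) (by linarith)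
    (by linarith) (by linarith)
  have e2 := rpow_le_two_rpow_mul (x := 1 + x) (y := 1 + t) b (by linarith) (by linarith)
    (by linarith) (by linarith)
  rw [Real.rpow_add (by norm_num)]
  calc jacobi a b x ≤ (2 ^ |a| * (1 - t) ^ a) * (2 ^ |b| * (1 + t) ^ b) := by
        have : 0 ≤ (1 + x) ^ b := Real.rpow_nonneg (by linarith) _
        have : 0 ≤ (1 - t) ^ a := Real.rpow_nonneg (by linarith) _
        exact mul_le_mul e1 e2 (by positivity) (by positivity)
    _ = _ := by rw [jacobi]; ring

theorem exists_deriv_jacobi (a b : ℝ) {x d : ℝ} (hd : 0 < d) (h1 : d ≤ 1 - x) (h2 : d ≤ 1 + x) :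
    ∃ D : ℝ, HasDerivAt (jacobi a b) D x ∧ |D| ≤ (|a| + |b|) / d * jacobi a b x := by
  have p1 : 0 < 1 - x := by linarith
  have p2 : 0 < 1 + x := by linarith
  have e1 : HasDerivAt (fun x : ℝ => (1 - x) ^ a) ((-1) * a * (1 - x) ^ (a - 1)) x :=
    ((hasDerivAt_id x).const_sub 1).rpow_const (Or.inl p1.ne')
  have e2 : HasDerivAt (fun x : ℝ => (1 + x) ^ b) (1 * b * (1 + x) ^ (b - 1)) x :=
    ((hasDerivAt_id x).const_add 1).rpow_const (Or.inl p2.ne')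
  refine ⟨_, e1.mul e2, ?_⟩
  rw [Real.rpow_sub_one p1.ne', Real.rpow_sub_one p2.ne']
  have e : -1 * a * ((1 - x) ^ a / (1 - x)) * (1 + x) ^ b +
      (1 - x) ^ a * (1 * b * ((1 + x) ^ b / (1 + x))) =
      (-a / (1 - x) + b / (1 + x)) * jacobi a b x := by
    rw [jacobi]; field_simp
  have hj : 0 < jacobi a b x := jacobi_pos a b ⟨by linarith, by linarith⟩
  rw [e, abs_mul, abs_of_pos hj]
  gcongr
  refine (abs_add_le _ _).trans ?_
  rw [abs_div, abs_div, abs_neg, abs_of_pos p1, abs_of_pos p2, add_div]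
  gcongr

/-! ### Elementary integrals -/

theorem lintegral_rpow_Ioo {r h : ℝ} (hr : -1 < r) (hh : 0 ≤ h) :
    ∫⁻ y in Ioo 0 h, ENNReal.ofReal (y ^ r) = ENNReal.ofReal (h ^ (r + 1) / (r + 1)) := by
  have hi : IntervalIntegrable (fun x : ℝ => x ^ r) volume 0 h :=
    intervalIntegral.intervalIntegrable_rpow' hr
  rw [intervalIntegrable_iff_integrableOn_Ioo_of_le hh] at hi
  rw [← ofReal_integral_eq_lintegral_ofReal hi]
  · rw [← integral_Ioc_eq_integral_Ioo, ← intervalIntegral.integral_of_le hh,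
      integral_rpow (Or.inl hr), Real.zero_rpow (by linarith), sub_zero]
  · filter_upwards [ae_restrict_mem measurableSet_Ioo] with x hx
    exact Real.rpow_nonneg hx.1.le _

theorem lintegral_abs_sub_le (g : ℝ → ℝ≥0∞) (t d : ℝ) :
    ∫⁻ x in Ioo (t - d) (t + d), g |x - t| ≤ 2 * ∫⁻ y in Ioo 0 d, g y := by
  have h1 : ∫⁻ x in Ioo t (t + d), g |x - t| = ∫⁻ y in Ioo 0 d, g y := by
    rw [← (measurePreserving_sub_right volume t).setLIntegral_comp_preimage_emb
      (MeasurableEquiv.subRight t).measurableEmbedding g (Ioo 0 d)]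
    have : (fun x => x - t) ⁻¹' Ioo 0 d = Ioo t (t + d) := by ext x; simp [add_comm]
    rw [this]
    refine setLIntegral_congr_fun measurableSet_Ioo fun x hx => ?_
    simp only [abs_of_pos (sub_pos.2 hx.1)]
  have h2 : ∫⁻ x in Ioo (t - d) t, g |x - t| = ∫⁻ y in Ioo 0 d, g y := by
    rw [← (volume.measurePreserving_sub_left t).setLIntegral_comp_preimage_emb
      (MeasurableEquiv.subLeft t).measurableEmbedding g (Ioo 0 d)]
    have : (fun x => t - x) ⁻¹' Ioo 0 d = Ioo (t - d) t := by
      ext x; simp [and_comm]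
    rw [this]
    refine setLIntegral_congr_fun measurableSet_Ioo fun x hx => ?_
    simp only [abs_of_neg (sub_neg.2 hx.2), neg_sub]
  have hsub : Ioo (t - d) (t + d) ⊆ (Ioo (t - d) t ∪ Ioo t (t + d)) ∪ {t} := by
    intro x hx
    simp only [mem_union, mem_Ioo, mem_singleton_iff] at *
    grind
  calc ∫⁻ x in Ioo (t - d) (t + d), g |x - t|
      ≤ ∫⁻ x in (Ioo (t - d) t ∪ Ioo t (t + d)) ∪ {t}, g |x - t| := lintegral_mono_set hsub
    _ ≤ (∫⁻ x in Ioo (t - d) t, g |x - t|) + (∫⁻ x in Ioo t (t + d), g |x - t|) +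
        ∫⁻ x in {t}, g |x - t| :=
      (lintegral_union_le _ _ _).trans (add_le_add_left (lintegral_union_le _ _ _) _)
    _ = _ := by rw [h1, h2]; simp [two_mul]

theorem lintegral_one_sub_Ioo (g : ℝ → ℝ≥0∞) :
    ∫⁻ x in Ioo 0 1, g (1 - x) = ∫⁻ y in Ioo 0 1, g y := by
  rw [← (volume.measurePreserving_sub_left (1 : ℝ)).setLIntegral_comp_preimage_emb
      (MeasurableEquiv.subLeft (1 : ℝ)).measurableEmbedding g (Ioo 0 1)]
  have : (fun x : ℝ => 1 - x) ⁻¹' Ioo 0 1 = Ioo 0 1 := by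
    ext x; simp
  rw [this]

theorem min_one_le_rpow {z θ : ℝ} (hz : 0 ≤ z) (h0 : 0 < θ) (h1 : θ ≤ 1) : min 1 z ≤ z ^ θ := by
  rcases le_total 1 z with h | h
  · exact (min_le_left _ _).trans (Real.one_le_rpow h h0.le)
  · exact (min_le_right _ _).trans (Real.self_le_rpow_of_le_one hz h h1)

/-- The exponent `θ = 1 / (1 + log N)` makes `N^θ` bounded. -/
theorem natCast_rpow_le {N : ℕ} (hN : 1 ≤ N) : (N : ℝ) ^ (1 / (1 + Real.log N)) ≤ Real.exp 1 := by
  have h0 : (1 : ℝ) ≤ N := by exact_mod_cast hN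
  have hl : 0 ≤ Real.log N := Real.log_nonneg h0
  rw [Real.rpow_def_of_pos (by linarith), Real.exp_le_exp, mul_one_div, div_le_one (by linarith)]
  linarith

/-! ### The part near `t` -/

/-- `Q u` is Hölder continuous near `t`, with the Lipschitz constant of the Markov inequality. -/
theorem exists_abs_sub_le_min (a b : ℝ) : ∃ K : ℝ, 0 < K ∧ ∀ (Q : ℝ[X]) (N : ℕ) (M : ℝ),
    1 ≤ N → Q.natDegree ≤ N →
    (∀ x ∈ Ioo (-1 : ℝ) 1, |Q.eval x| * jacobi (plusPart a) (plusPart b) x ≤ M) →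
    ∀ t ∈ Ioo (-1 : ℝ) 1, ∀ x, |x - t| < (1 - |t|) / 2 →
      |Q.eval x * jacobi a b x - Q.eval t * jacobi a b t| * uMinus a b t ≤
        K * M * min 1 (N ^ 2 * |x - t| / ((1 - |t|) / 2)) := by
  set A := plusPart a
  set B := plusPart b
  set K₁ : ℝ := 2 ^ (|A| + |B|) with hK₁
  set K₂ : ℝ := 2 ^ (|a| + |b|) with hK₂
  have hK₁0 : 0 < K₁ := by positivity
  have hK₂0 : 0 < K₂ := by positivity
  refine ⟨(2 + (|a| + |b|)) * (K₁ * K₂), by positivity, ?_⟩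
  intro Q N M hN hQ hM t ht x hx
  set d := (1 - |t|) / 2 with hd
  have hN0 : (1 : ℝ) ≤ N := by exact_mod_cast hN
  have h0 := abs_lt.2 ht
  have h1 := le_abs_self t
  have h2 := neg_abs_le t
  have hd0 : 0 < d := by linarith
  have hv : 0 < jacobi A B t := jacobi_pos _ _ ht
  have hu : 0 < jacobi a b t := jacobi_pos _ _ ht
  have hm : 0 < uMinus a b t := uMinus_pos _ _ ht
  have hM0 : 0 ≤ M := (mul_nonneg (abs_nonneg _) hv.le).trans (hM t ht)
  have hvu : jacobi A B t = jacobi a b t * uMinus a b t := (jacobi_mul_uMinus a b ht).symm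
  have hIcc : ∀ y ∈ Icc (t - d) (t + d), |y - t| ≤ d ∧ y ∈ Ioo (-1 : ℝ) 1 := by
    intro y hy
    refine ⟨abs_le.2 ⟨by linarith [hy.1], by linarith [hy.2]⟩, ?_, ?_⟩ <;> linarith [hy.1, hy.2]
  have hQb : ∀ y ∈ Icc (t - d) (t + d), |Q.eval y| ≤ M * K₁ / jacobi A B t := by
    intro y hy
    obtain ⟨hy1, hy2⟩ := hIcc y hy
    -- comparability of `1 / v` at `y` and at `t`
    have h3 : jacobi A B t ≤ K₁ * jacobi A B y := by
      have h4 := jacobi_le_mul_jacobi (-A) (-B) ht hy1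
      rw [abs_neg, abs_neg, ← hK₁] at h4
      have e1 : jacobi (-A) (-B) y * jacobi A B y = 1 := by
        rw [jacobi_mul_jacobi _ _ _ _ hy2]; simp [jacobi]
      have e2 : jacobi (-A) (-B) t * jacobi A B t = 1 := by
        rw [jacobi_mul_jacobi _ _ _ _ ht]; simp [jacobi]
      have hvy : 0 < jacobi A B y := jacobi_pos _ _ hy2
      calc jacobi A B t = (jacobi (-A) (-B) y * jacobi A B y) * jacobi A B t := by rw [e1, one_mul]
        _ ≤ ((K₁ * jacobi (-A) (-B) t) * jacobi A B y) * jacobi A B t := by gcongr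
        _ = K₁ * jacobi A B y * (jacobi (-A) (-B) t * jacobi A B t) := by ring
        _ = _ := by rw [e2, mul_one]
    rw [le_div_iff₀ hv]
    calc |Q.eval y| * jacobi A B t ≤ |Q.eval y| * (K₁ * jacobi A B y) := by gcongr
      _ = |Q.eval y| * jacobi A B y * K₁ := by ring
      _ ≤ M * K₁ := by gcongr; exact hM y hy2
  have hub : ∀ y ∈ Icc (t - d) (t + d), jacobi a b y ≤ K₂ * jacobi a b t := fun y hy =>
    jacobi_le_mul_jacobi a b ht (hIcc y hy).1
  have htm : t ∈ Icc (t - d) (t + d) := ⟨by linarith, by linarith⟩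
  have hxm : x ∈ Icc (t - d) (t + d) := by
    have := abs_lt.1 hx
    constructor <;> linarith
  have hG : ∀ y ∈ Icc (t - d) (t + d),
      |Q.eval y * jacobi a b y| ≤ K₁ * K₂ * M / uMinus a b t := by
    intro y hy
    have hyu : 0 < jacobi a b y := jacobi_pos _ _ (hIcc y hy).2
    rw [abs_mul, abs_of_pos hyu]
    calc |Q.eval y| * jacobi a b y ≤ (M * K₁ / jacobi A B t) * (K₂ * jacobi a b t) := by
          gcongr
          · exact hQb y hy
          · exact hub y hy
      _ = _ := by rw [hvu]; field_simp
  have hder : ∀ y ∈ Icc (t - d) (t + d), ∃ D : ℝ,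
      HasDerivAt (fun y => Q.eval y * jacobi a b y) D y ∧
      ‖D‖ ≤ (2 + (|a| + |b|)) * (K₁ * K₂) * M * N ^ 2 / (d * uMinus a b t) := by
    intro y hy
    have hyu : 0 < jacobi a b y := jacobi_pos _ _ (hIcc y hy).2
    obtain ⟨D, hD, hDb⟩ := exists_deriv_jacobi a b (x := y) hd0 (by linarith [hy.2])
      (by linarith [hy.1])
    refine ⟨_, (Q.hasDerivAt y).mul hD, ?_⟩
    have hQ' := abs_derivative_le hQ (by linarith) hQb hy
    have e1 : |Q.derivative.eval y * jacobi a b y| ≤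
        (4 * N ^ 2 * (M * K₁ / jacobi A B t) / (t + d - (t - d))) * (K₂ * jacobi a b t) := by
      rw [abs_mul, abs_of_pos hyu]
      gcongr
      · exact div_nonneg (by positivity) (by linarith)
      · exact hub y hy
    have e2 : |Q.eval y * D| ≤
        (M * K₁ / jacobi A B t) * ((|a| + |b|) / d * (K₂ * jacobi a b t)) := by
      rw [abs_mul]
      gcongr
      · exact hQb y hy
      · refine hDb.trans ?_
        gcongr
        exact hub y hy
    have e3 : (4 * N ^ 2 * (M * K₁ / jacobi A B t) / (t + d - (t - d))) * (K₂ * jacobi a b t) =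
        2 * (K₁ * K₂) * M * N ^ 2 / (d * uMinus a b t) := by
      rw [hvu, show t + d - (t - d) = 2 * d by ring]; field_simp; ring
    have e4 : (M * K₁ / jacobi A B t) * ((|a| + |b|) / d * (K₂ * jacobi a b t)) ≤
        (|a| + |b|) * (K₁ * K₂) * M * N ^ 2 / (d * uMinus a b t) := by
      calc _ = (|a| + |b|) * (K₁ * K₂) * M * 1 / (d * uMinus a b t) := by
            rw [hvu]; field_simp
        _ ≤ _ := by gcongr; nlinarith
    refine (norm_add_le _ _).trans ?_
    rw [Real.norm_eq_abs, Real.norm_eq_abs]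
    calc _ ≤ 2 * (K₁ * K₂) * M * N ^ 2 / (d * uMinus a b t) +
          (|a| + |b|) * (K₁ * K₂) * M * N ^ 2 / (d * uMinus a b t) := by linarith
      _ = _ := by ring
  choose! D hD hDb using hder
  have hmv := (convex_Icc (t - d) (t + d)).norm_image_sub_le_of_norm_hasDerivWithin_le
    (fun y hy => (hD y hy).hasDerivWithinAt) hDb htm hxm
  rw [Real.norm_eq_abs, Real.norm_eq_abs] at hmv
  rw [mul_min_of_nonneg _ _ (by positivity), le_min_iff]
  constructor
  · have e1 := hG x hxm
    have e2 := hG t htm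
    have e3 := abs_sub (Q.eval x * jacobi a b x) (Q.eval t * jacobi a b t)
    calc |Q.eval x * jacobi a b x - Q.eval t * jacobi a b t| * uMinus a b t
        ≤ (K₁ * K₂ * M / uMinus a b t + K₁ * K₂ * M / uMinus a b t) * uMinus a b t := by
          gcongr; linarith
      _ = 2 * (K₁ * K₂) * M := by field_simp; ring
      _ ≤ (2 + (|a| + |b|)) * (K₁ * K₂) * M * 1 := by
          rw [mul_one]
          gcongr
          linarith [abs_nonneg a, abs_nonneg b]
  · calc |Q.eval x * jacobi a b x - Q.eval t * jacobi a b t| * uMinus a b t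
        ≤ (2 + (|a| + |b|)) * (K₁ * K₂) * M * N ^ 2 / (d * uMinus a b t) * |x - t| *
          uMinus a b t := by gcongr
      _ = _ := by field_simp

/-- The contribution of `|x - t| < (1 - |t|) / 2` to the regularized Hilbert transform of a
polynomial. Replacing `min 1 z` by `z ^ θ`, `θ = 1 / (1 + log N)`, costs only a constant factor and
leaves the integral of a power. -/
theorem exists_lintegral_near_le (a b : ℝ) : ∃ K : ℝ, 0 < K ∧ ∀ (Q : ℝ[X]) (N : ℕ) (M : ℝ),
    1 ≤ N → Q.natDegree ≤ N →
    (∀ x ∈ Ioo (-1 : ℝ) 1, |Q.eval x| * jacobi (plusPart a) (plusPart b) x ≤ M) →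
    ∀ t ∈ Ioo (-1 : ℝ) 1,
      ENNReal.ofReal (uMinus a b t) * (∫⁻ x in Ioo (t - (1 - |t|) / 2) (t + (1 - |t|) / 2),
        ‖regKernel a b (fun x => Q.eval x) t x‖ₑ) ≤
        ENNReal.ofReal (K * M * (1 + Real.log N)) := by
  obtain ⟨K, hK, h⟩ := exists_abs_sub_le_min a b
  refine ⟨2 * K * Real.exp 1 ^ 2, by positivity, ?_⟩
  intro Q N M hN hQ hM t ht
  have hmin := h Q N M hN hQ hM t ht
  have hN0 : (1 : ℝ) ≤ N := by exact_mod_cast hN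
  have hl : 0 ≤ Real.log N := Real.log_nonneg hN0
  set d := (1 - |t|) / 2 with hd
  have hd0 : 0 < d := by linarith [abs_lt.2 ht]
  have hm : 0 < uMinus a b t := uMinus_pos _ _ ht
  have hM0 : 0 ≤ M :=
    (mul_nonneg (abs_nonneg _) (jacobi_pos _ _ ht).le).trans (hM t ht)
  set θ := 1 / (1 + Real.log N) with hθ
  have hθ0 : 0 < θ := by positivity
  have hθ1 : θ ≤ 1 := by rw [hθ, div_le_one (by linarith)]; linarith
  set c := K * M * (Real.exp 1 ^ 2 / d ^ θ) with hc
  have hpt : ∀ x ∈ Ioo (t - d) (t + d),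
      ENNReal.ofReal (uMinus a b t) * ‖regKernel a b (fun x => Q.eval x) t x‖ₑ ≤
        ENNReal.ofReal c * ENNReal.ofReal (|x - t| ^ (θ - 1)) := by
    intro x hx
    have hx' : |x - t| < d := abs_lt.2 ⟨by linarith [hx.1], by linarith [hx.2]⟩
    rcases eq_or_ne x t with rfl | hxt
    · simp [regKernel]
    have hx0 : 0 < |x - t| := abs_pos.2 (sub_ne_zero.2 hxt)
    rw [← ofReal_norm, ← ENNReal.ofReal_mul hm.le, ← ENNReal.ofReal_mul (by positivity)]
    apply ENNReal.ofReal_le_ofReal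
    rw [regKernel, ← hd, if_pos hx', norm_div, Real.norm_eq_abs, Real.norm_eq_abs]
    have h1 : min 1 (N ^ 2 * |x - t| / d) ≤ Real.exp 1 ^ 2 / d ^ θ * |x - t| ^ θ := by
      refine (min_one_le_rpow (by positivity) hθ0 hθ1).trans ?_
      rw [Real.div_rpow (by positivity) hd0.le, Real.mul_rpow (by positivity) hx0.le]
      have h2 : ((N : ℝ) ^ 2) ^ θ ≤ Real.exp 1 ^ 2 := by
        rw [← Real.rpow_natCast, ← Real.rpow_mul (by positivity), mul_comm,
          Real.rpow_mul (by positivity), Real.rpow_natCast]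
        gcongr
        exact natCast_rpow_le hN
      calc _ ≤ Real.exp 1 ^ 2 * |x - t| ^ θ / d ^ θ := by gcongr
        _ = _ := by ring
    rw [Real.rpow_sub_one hx0.ne', mul_div_assoc', mul_div_assoc']
    refine div_le_div_of_nonneg_right ?_ hx0.le
    rw [mul_comm (uMinus a b t)]
    refine (hmin x hx').trans ?_
    rw [hc, mul_assoc (K * M)]
    gcongr
  rw [← lintegral_const_mul' _ _ ENNReal.ofReal_ne_top]
  calc _ ≤ ∫⁻ x in Ioo (t - d) (t + d), ENNReal.ofReal c * ENNReal.ofReal (|x - t| ^ (θ - 1)) :=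
        setLIntegral_mono' measurableSet_Ioo hpt
    _ ≤ 2 * ∫⁻ y in Ioo 0 d, ENNReal.ofReal c * ENNReal.ofReal (y ^ (θ - 1)) :=
        lintegral_abs_sub_le (fun y => ENNReal.ofReal c * ENNReal.ofReal (y ^ (θ - 1))) t d
    _ = ENNReal.ofReal (2 * (c * (d ^ θ / θ))) := by
        rw [lintegral_const_mul' _ _ ENNReal.ofReal_ne_top,
          lintegral_rpow_Ioo (by linarith) hd0.le, sub_add_cancel,
          ← ENNReal.ofReal_mul (by positivity), ENNReal.ofReal_mul (by norm_num : (0:ℝ) ≤ 2)]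
        simp
    _ = _ := by
        congr 1
        have : d ^ θ ≠ 0 := by positivity
        rw [hc, hθ]
        field_simp

/-! ### The part away from `t` -/

theorem jacobi_nonneg (a b : ℝ) {x : ℝ} (hx : x ∈ Icc (-1 : ℝ) 1) : 0 ≤ jacobi a b x :=
  mul_nonneg (Real.rpow_nonneg (by linarith [hx.2]) _) (Real.rpow_nonneg (by linarith [hx.1]) _)

theorem endpoint_coeff_nonneg (a b : ℝ) :
    0 ≤ uPlus a b (-1) * uMinus a b (-1) ∧ 0 ≤ uPlus a b 1 * uMinus a b 1 :=
  ⟨mul_nonneg (jacobi_nonneg _ _ (by norm_num)) (jacobi_nonneg _ _ (by norm_num)),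
    mul_nonneg (jacobi_nonneg _ _ (by norm_num)) (jacobi_nonneg _ _ (by norm_num))⟩

theorem u₂_nonneg (a b : ℝ) {t : ℝ} (ht : t ∈ Ioo (-1 : ℝ) 1) : 0 ≤ u₂ a b t := by
  obtain ⟨h1, h2⟩ := endpoint_coeff_nonneg a b
  have := uMinus_pos a b ht
  rw [u₂]
  positivity

theorem u₂_le_uMinus (a b : ℝ) {t : ℝ} (ht : t ∈ Ioo (-1 : ℝ) 1) : u₂ a b t ≤ uMinus a b t := by
  obtain ⟨h1, h2⟩ := endpoint_coeff_nonneg a b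
  refine div_le_self (uMinus_pos a b ht).le ?_
  have e1 := mul_nonneg h1 (abs_nonneg (Real.log (1 + t)))
  have e2 := mul_nonneg h2 (abs_nonneg (Real.log (1 - t)))
  linarith

theorem uMinus_le (a b : ℝ) {t : ℝ} (ht : t ∈ Ioo (-1 : ℝ) 1) :
    uMinus a b t ≤ 2 ^ minusPart b * (1 - t) ^ minusPart a := by
  rw [uMinus, jacobi, mul_comm]
  have : 0 ≤ (1 - t) ^ minusPart a := Real.rpow_nonneg (by linarith [ht.2]) _
  exact mul_le_mul_of_nonneg_right (Real.rpow_le_rpow (by linarith [ht.1]) (by linarith [ht.2])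
    (minusPart_nonneg b)) this

/-- For `a = 0` the function `u₂` decays logarithmically at `1`. -/
theorem u₂_zero_le (b : ℝ) {t : ℝ} (ht : t ∈ Ioo (-1 : ℝ) 1) :
    u₂ 0 b t ≤ 2 ^ minusPart b / (1 + |Real.log (1 - t)|) := by
  obtain ⟨h1, h2⟩ := endpoint_coeff_nonneg 0 b
  have e0 : 1 ≤ uPlus 0 b 1 * uMinus 0 b 1 := by
    simp only [uPlus, uMinus, jacobi, plusPart, minusPart]
    norm_num
    exact one_le_mul_of_one_le_of_one_le (Real.one_le_rpow (by norm_num) (le_max_left _ _))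
      (Real.one_le_rpow (by norm_num) (le_max_left _ _))
  have hm := uMinus_le 0 b ht
  have e1 : minusPart 0 = 0 := by simp [minusPart]
  rw [e1, Real.rpow_zero, mul_one] at hm
  have e2 := mul_nonneg h1 (abs_nonneg (Real.log (1 + t)))
  have e3 := mul_le_mul_of_nonneg_right e0 (abs_nonneg (Real.log (1 - t)))
  exact div_le_div₀ (by positivity) hm (by positivity) (by linarith)

theorem measurableSet_far (t : ℝ) : MeasurableSet {x : ℝ | (1 - |t|) / 2 ≤ |x - t|} :=
  measurableSet_le measurable_const (by fun_prop)

/-- Away from `t`, in the right half of the interval, `|x - t|` dominates `1 - t` and `1 - x`. -/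
theorem far_bounds {t x : ℝ} (ht : t ∈ Ioo (-1 : ℝ) 1) (hx : x ∈ Ioo (0 : ℝ) 1)
    (hf : (1 - |t|) / 2 ≤ |x - t|) : (1 - t) / 6 ≤ |x - t| ∧ (1 - x) / 3 ≤ |x - t| := by
  have h1 := ht.1
  have h2 := ht.2
  have h3 := hx.1
  have h4 := hx.2
  rcases le_total 0 t with h | h
  · rw [abs_of_nonneg h] at hf
    rcases abs_cases (x - t) with ⟨e, _⟩ | ⟨e, _⟩ <;> rw [e] at hf ⊢ <;> constructor <;> linarith
  · rw [abs_of_nonpos h] at hf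
    have e : |x - t| = x - t := abs_of_nonneg (by linarith)
    rw [e] at hf ⊢
    constructor <;> linarith

theorem enorm_regKernel_far_le {a b t x : ℝ} {F : ℝ → ℝ} (ht : t ∈ Ioo (-1 : ℝ) 1)
    (hx : x ∈ Ioo (0 : ℝ) 1) (hf : (1 - |t|) / 2 ≤ |x - t|) :
    ‖regKernel a b F t x‖ₑ ≤
      ENNReal.ofReal (|F x| * jacobi a b x * min (6 / (1 - t)) (3 / (1 - x))) := by
  obtain ⟨h1, h2⟩ := far_bounds ht hx hf
  have h3 : 0 < 1 - t := by linarith [ht.2]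
  have h4 : 0 < 1 - x := by linarith [hx.2]
  have h5 : 0 < jacobi a b x := jacobi_pos a b ⟨by linarith [hx.1], hx.2⟩
  rw [regKernel, if_neg (not_lt.2 hf), sub_zero, ← ofReal_norm, norm_div, norm_mul,
    Real.norm_eq_abs, Real.norm_eq_abs, Real.norm_eq_abs, abs_of_pos h5, div_eq_mul_inv]
  apply ENNReal.ofReal_le_ofReal
  gcongr
  refine le_min ?_ ?_
  · rw [inv_le_comm₀ (by linarith) (by positivity), inv_div]; exact h1
  · rw [inv_le_comm₀ (by linarith) (by positivity), inv_div]; exact h2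

theorem abs_mul_jacobi_le {a b M x : ℝ} {F : ℝ → ℝ} (hx : x ∈ Ioo (0 : ℝ) 1)
    (hM : ∀ x ∈ Ioo (-1 : ℝ) 1, |F x| * jacobi (plusPart a) (plusPart b) x ≤ M) :
    |F x| * jacobi a b x ≤ M * (1 - x) ^ (-minusPart a) := by
  have hx' : x ∈ Ioo (-1 : ℝ) 1 := ⟨by linarith [hx.1], hx.2⟩
  have h4 : 0 < 1 - x := by linarith [hx.2]
  have hm := uMinus_pos a b hx'
  have h1 := hM x hx'
  rw [← jacobi_mul_uMinus a b hx'] at h1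
  have h2 : (1 - x) ^ minusPart a ≤ uMinus a b x := by
    rw [uMinus, jacobi]
    exact le_mul_of_one_le_right (by positivity)
      (Real.one_le_rpow (by linarith [hx.1]) (minusPart_nonneg b))
  rw [Real.rpow_neg h4.le, ← div_eq_mul_inv, le_div_iff₀ (by positivity)]
  refine le_trans ?_ h1
  rw [← mul_assoc]
  have := jacobi_pos a b hx'
  gcongr

/-- The contribution of `x > 0` away from `t`, for `a > 0`. There `|Q| u` is bounded by a constant
and by `(N² (1 - x))^a`; interpolating between the two bounds with the exponent
`θ = 1 / (1 + log N)` makes it integrable against `dx / (1 - x)`. -/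
theorem exists_lintegral_right_le_of_pos {a : ℝ} (b : ℝ) (ha : 0 < a) :
    ∃ K : ℝ, 0 < K ∧ ∀ (Q : ℝ[X]) (N : ℕ) (M : ℝ), 1 ≤ N → Q.natDegree ≤ N →
    (∀ x ∈ Ioo (-1 : ℝ) 1, |Q.eval x| * jacobi (plusPart a) (plusPart b) x ≤ M) →
    ∀ t ∈ Ioo (-1 : ℝ) 1,
      ENNReal.ofReal (u₂ a b t) * (∫⁻ x in Ioo 0 1 ∩ {x | (1 - |t|) / 2 ≤ |x - t|},
        ‖regKernel a b (fun x => Q.eval x) t x‖ₑ) ≤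
        ENNReal.ofReal (K * M * (1 + Real.log N)) := by
  have hpa : plusPart a = a := max_eq_right ha.le
  have hma : minusPart a = 0 := max_eq_left (by linarith)
  refine ⟨2 ^ minusPart b * (2 * 2 ^ |b| * (8 ^ a * (Real.exp 1 ^ (2 * a)))) * (3 / a),
    by positivity, ?_⟩
  intro Q N M hN hQ hM t ht
  have hN0 : (1 : ℝ) ≤ N := by exact_mod_cast hN
  have hl : 0 ≤ Real.log N := Real.log_nonneg hN0
  have hM0 : 0 ≤ M := (mul_nonneg (abs_nonneg _) (jacobi_pos _ _ ht).le).trans (hM t ht)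
  set θ := 1 / (1 + Real.log N) with hθ
  have hθ0 : 0 < θ := by positivity
  have hθ1 : θ ≤ 1 := by rw [hθ, div_le_one (by linarith)]; linarith
  have hgrow : ∀ x ∈ Icc (0 : ℝ) 1, |Q.eval x| ≤ 2 * M * (8 * (N : ℝ) ^ 2) ^ a := by
    intro x hx
    refine abs_eval_le_of_weighted hQ hN ha.le (fun y hy => ?_) hx
    refine le_trans ?_ (hM y ⟨by linarith [hy.1], hy.2⟩)
    rw [jacobi, hpa]
    gcongr
    exact le_mul_of_one_le_right (Real.rpow_nonneg (by linarith [hy.2]) _)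
      (Real.one_le_rpow (by linarith [hy.1]) (plusPart_nonneg b))
  set c := M * (2 * 2 ^ |b| * (8 ^ a * (Real.exp 1 ^ (2 * a)))) with hc
  have hpt : ∀ x ∈ Ioo (0 : ℝ) 1, |Q.eval x| * jacobi a b x ≤ c * (1 - x) ^ (a * θ) := by
    intro x hx
    have hx' : x ∈ Ioo (-1 : ℝ) 1 := ⟨by linarith [hx.1], hx.2⟩
    have h4 : 0 < 1 - x := by linarith [hx.2]
    have h1 : |Q.eval x| * jacobi a b x ≤ M := by
      have := abs_mul_jacobi_le hx hM
      rwa [hma, neg_zero, Real.rpow_zero, mul_one] at this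
    have h5 : 0 < 1 + x := by linarith [hx.1]
    have hb : (1 + x) ^ b ≤ 2 ^ |b| := by
      calc (1 + x) ^ b ≤ (1 + x) ^ |b| :=
            Real.rpow_le_rpow_of_exponent_le (by linarith [hx.1]) (le_abs_self b)
        _ ≤ _ := Real.rpow_le_rpow (by linarith [hx.1]) (by linarith [hx.2]) (abs_nonneg b)
    have hb1 : (1 : ℝ) ≤ 2 ^ |b| := Real.one_le_rpow (by norm_num) (abs_nonneg b)
    have h2 : |Q.eval x| * jacobi a b x ≤
        2 * 2 ^ |b| * M * ((8 * (N : ℝ) ^ 2) ^ a * (1 - x) ^ a) := by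
      rw [jacobi]
      calc |Q.eval x| * ((1 - x) ^ a * (1 + x) ^ b)
          ≤ (2 * M * (8 * (N : ℝ) ^ 2) ^ a) * ((1 - x) ^ a * 2 ^ |b|) := by
            gcongr
            exact hgrow x ⟨hx.1.le, hx.2.le⟩
        _ = _ := by ring
    have h3 : |Q.eval x| * jacobi a b x ≤
        2 * 2 ^ |b| * M * min 1 ((8 * (N : ℝ) ^ 2) ^ a * (1 - x) ^ a) := by
      rw [mul_min_of_nonneg _ _ (by positivity), mul_one]
      exact le_min (by nlinarith) h2
    refine h3.trans ?_
    have h5 := min_one_le_rpow (z := (8 * (N : ℝ) ^ 2) ^ a * (1 - x) ^ a) (by positivity) hθ0 hθ1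
    have h6 : ((8 * (N : ℝ) ^ 2) ^ a * (1 - x) ^ a) ^ θ ≤
        8 ^ a * Real.exp 1 ^ (2 * a) * (1 - x) ^ (a * θ) := by
      rw [Real.mul_rpow (by positivity) (by positivity), ← Real.rpow_mul h4.le]
      gcongr
      rw [Real.mul_rpow (by norm_num) (by positivity),
        Real.mul_rpow (by positivity) (by positivity)]
      gcongr
      · rw [← Real.rpow_mul (by norm_num)]
        exact Real.rpow_le_rpow_of_exponent_le (by norm_num) (by nlinarith)
      · have e : (((N : ℝ) ^ 2) ^ a) ^ θ = ((N : ℝ) ^ θ) ^ (2 * a) := by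
          rw [← Real.rpow_natCast, ← Real.rpow_mul (by positivity), ← Real.rpow_mul (by positivity),
            ← Real.rpow_mul (by positivity)]
          congr 1
          push_cast
          ring
        rw [e]
        exact Real.rpow_le_rpow (by positivity) (natCast_rpow_le hN) (by positivity)
    calc _ ≤ 2 * 2 ^ |b| * M * (8 ^ a * Real.exp 1 ^ (2 * a) * (1 - x) ^ (a * θ)) := by
          gcongr; exact h5.trans h6
      _ = _ := by rw [hc]; ring
  have hu : u₂ a b t ≤ 2 ^ minusPart b := by
    have := (u₂_le_uMinus a b ht).trans (uMinus_le a b ht)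
    rwa [hma, Real.rpow_zero, mul_one] at this
  have hc0 : 0 ≤ c := by positivity
  calc _ ≤ ENNReal.ofReal (2 ^ minusPart b) *
        ∫⁻ x in Ioo (0 : ℝ) 1, ENNReal.ofReal (3 * c) * ENNReal.ofReal ((1 - x) ^ (a * θ - 1)) := by
        refine mul_le_mul' (ENNReal.ofReal_le_ofReal hu) ?_
        refine (setLIntegral_mono' (measurableSet_Ioo.inter (measurableSet_far t))
          fun x hx => ?_).trans
          (lintegral_mono_set inter_subset_left)
        have h4 : 0 < 1 - x := by linarith [hx.1.2]
        refine (enorm_regKernel_far_le ht hx.1 hx.2).trans ?_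
        rw [← ENNReal.ofReal_mul (by positivity)]
        apply ENNReal.ofReal_le_ofReal
        rw [Real.rpow_sub_one h4.ne']
        calc _ ≤ c * (1 - x) ^ (a * θ) * (3 / (1 - x)) := by
              refine mul_le_mul (hpt x hx.1) (min_le_right _ _) ?_ (by positivity)
              exact le_min (div_nonneg (by norm_num) (by linarith [ht.2])) (by positivity)
          _ = _ := by ring
    _ = ENNReal.ofReal (2 ^ minusPart b * (3 * c * (1 / (a * θ)))) := by
        rw [lintegral_const_mul' _ _ ENNReal.ofReal_ne_top,
          lintegral_one_sub_Ioo (fun y => ENNReal.ofReal (y ^ (a * θ - 1))),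
          lintegral_rpow_Ioo (by nlinarith [mul_pos ha hθ0]) zero_le_one, sub_add_cancel,
          Real.one_rpow, ← ENNReal.ofReal_mul (by positivity), ← ENNReal.ofReal_mul (by positivity)]
    _ = _ := by
        congr 1
        rw [hc, hθ]
        field_simp

/-- The integral `∫_0^1 y^a min(6/h, 3/y) dy`, split at `y = h`. -/
theorem lintegral_min_le {a h : ℝ} (ha : -1 < a) (h0 : 0 < h) :
    ∫⁻ y in Ioo 0 1, ENNReal.ofReal (y ^ a * min (6 / h) (3 / y)) ≤
      ENNReal.ofReal (6 / (a + 1) * h ^ a + 3 * ∫ y in (min h 1)..1, y ^ (a - 1)) := by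
  set k := min h 1 with hk
  have hk0 : 0 < k := lt_min h0 one_pos
  have hk1 : k ≤ 1 := min_le_right _ _
  have hkh : k ≤ h := min_le_left _ _
  have hsub : Ioo (0 : ℝ) 1 ⊆ Ioo 0 k ∪ {k} ∪ Ioo k 1 := by
    intro x hx
    simp only [mem_union, mem_Ioo, mem_singleton_iff] at *
    grind
  have hi : IntervalIntegrable (fun y : ℝ => y ^ (a - 1)) volume k 1 := by
    refine intervalIntegral.intervalIntegrable_rpow (Or.inr ?_)
    rw [uIcc_of_le hk1]
    exact fun h => absurd h.1 (not_le.2 hk0)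
  have h1 : ∫⁻ y in Ioo 0 k, ENNReal.ofReal (y ^ a * min (6 / h) (3 / y)) ≤
      ENNReal.ofReal (6 / (a + 1) * h ^ a) := by
    calc _ ≤ ∫⁻ y in Ioo 0 k, ENNReal.ofReal (6 / h) * ENNReal.ofReal (y ^ a) := by
          refine setLIntegral_mono' measurableSet_Ioo fun y hy => ?_
          rw [← ENNReal.ofReal_mul (by positivity)]
          apply ENNReal.ofReal_le_ofReal
          rw [mul_comm]
          have : 0 ≤ y ^ a := Real.rpow_nonneg hy.1.le _
          gcongr
          exact min_le_left _ _
      _ = ENNReal.ofReal (6 / h * (k ^ (a + 1) / (a + 1))) := by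
          rw [lintegral_const_mul' _ _ ENNReal.ofReal_ne_top, lintegral_rpow_Ioo ha hk0.le,
            ← ENNReal.ofReal_mul (by positivity)]
      _ ≤ _ := by
          apply ENNReal.ofReal_le_ofReal
          have h2 : k ^ (a + 1) ≤ h ^ a * h := by
            rw [← Real.rpow_add_one h0.ne']
            exact Real.rpow_le_rpow hk0.le hkh (by linarith)
          have h3 : 0 < a + 1 := by linarith
          calc 6 / h * (k ^ (a + 1) / (a + 1)) ≤ 6 / h * (h ^ a * h / (a + 1)) := by gcongr
            _ = _ := by field_simp
  have h2 : ∫⁻ y in Ioo k 1, ENNReal.ofReal (y ^ a * min (6 / h) (3 / y)) ≤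
      ENNReal.ofReal (3 * ∫ y in k..1, y ^ (a - 1)) := by
    rw [intervalIntegral.integral_of_le hk1, integral_Ioc_eq_integral_Ioo,
      ENNReal.ofReal_mul (by norm_num), ofReal_integral_eq_lintegral_ofReal
        ((intervalIntegrable_iff_integrableOn_Ioo_of_le hk1).1 hi),
      ← lintegral_const_mul' _ _ ENNReal.ofReal_ne_top]
    · refine setLIntegral_mono' measurableSet_Ioo fun y hy => ?_
      have hy0 : 0 < y := hk0.trans hy.1
      rw [← ENNReal.ofReal_mul (by norm_num)]
      apply ENNReal.ofReal_le_ofReal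
      rw [Real.rpow_sub_one hy0.ne']
      calc _ ≤ y ^ a * (3 / y) := by gcongr; exact min_le_right _ _
        _ = _ := by ring
    · filter_upwards [ae_restrict_mem measurableSet_Ioo] with y hy
      exact Real.rpow_nonneg (hk0.trans hy.1).le _
  have h3 : 0 ≤ ∫ y in k..1, y ^ (a - 1) :=
    intervalIntegral.integral_nonneg hk1 fun y hy => Real.rpow_nonneg (hk0.le.trans hy.1) _
  have h4 : 0 < a + 1 := by linarith
  rw [ENNReal.ofReal_add (by positivity) (by positivity)]
  calc _ ≤ _ := lintegral_mono_set hsub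
    _ ≤ _ := (lintegral_union_le _ _ _).trans (add_le_add_left (lintegral_union_le _ _ _) _)
    _ ≤ _ := by
      gcongr
      simpa using h1

/-- For `a ≤ 0` the function `u₂` compensates for the growth of `∫_0^1 y^a min(6/h, 3/y) dy` as
`h = 1 - t` tends to `0`: it is of order `h^a` for `a < 0` and logarithmic for `a = 0`. -/
theorem exists_u₂_mul_le {a : ℝ} (b : ℝ) (ha : -1 < a) (ha0 : a ≤ 0) :
    ∃ K : ℝ, 0 < K ∧ ∀ t ∈ Ioo (-1 : ℝ) 1,
      u₂ a b t * (6 / (a + 1) * (1 - t) ^ a + 3 * ∫ y in (min (1 - t) 1)..1, y ^ (a - 1)) ≤ K := by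
  have ha1 : 0 < a + 1 := by linarith
  have hmem : ∀ h : ℝ, 0 < h → (0 : ℝ) ∉ uIcc (min h 1) 1 := by
    intro h h0
    rw [uIcc_of_le (min_le_right _ _)]
    exact fun hh => absurd hh.1 (not_le.2 (lt_min h0 one_pos))
  rcases ha0.lt_or_eq with ha0 | rfl
  · have hma : minusPart a = -a := max_eq_right (by linarith)
    have hn : 0 < -a := by linarith
    refine ⟨2 ^ minusPart b * (6 / (a + 1) + 3 * (2 ^ |a| / (-a))), by positivity, ?_⟩
    intro t ht
    have h0 : 0 < 1 - t := by linarith [ht.2]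
    have hk0 : 0 < min (1 - t) 1 := lt_min h0 one_pos
    rw [integral_rpow (Or.inr ⟨by linarith, hmem _ h0⟩), sub_add_cancel, Real.one_rpow]
    have hu := (u₂_le_uMinus a b ht).trans (uMinus_le a b ht)
    rw [hma] at hu
    have h1 : (min (1 - t) 1) ^ a ≤ 2 ^ |a| * (1 - t) ^ a := by
      refine rpow_le_two_rpow_mul a hk0 h0 (by linarith [min_le_left (1 - t) 1]) ?_
      rcases min_cases (1 - t) 1 with ⟨e, _⟩ | ⟨e, _⟩ <;> rw [e] <;> linarith [ht.1]
    have h2 : (1 - (min (1 - t) 1) ^ a) / a ≤ 2 ^ |a| / (-a) * (1 - t) ^ a := by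
      rw [← neg_div_neg_eq, div_mul_eq_mul_div]
      gcongr
      linarith
    have h3 : (1 - t) ^ (-a) * (1 - t) ^ a = 1 := by
      rw [← Real.rpow_add h0]; simp
    calc _ ≤ u₂ a b t * (6 / (a + 1) * (1 - t) ^ a + 3 * (2 ^ |a| / (-a) * (1 - t) ^ a)) := by
          have := u₂_nonneg a b ht
          gcongr
      _ ≤ (2 ^ minusPart b * (1 - t) ^ (-a)) *
          (6 / (a + 1) * (1 - t) ^ a + 3 * (2 ^ |a| / (-a) * (1 - t) ^ a)) := by gcongr
      _ = 2 ^ minusPart b * (6 / (a + 1) + 3 * (2 ^ |a| / (-a))) *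
          ((1 - t) ^ (-a) * (1 - t) ^ a) := by ring
      _ = _ := by rw [h3, mul_one]
  · refine ⟨2 ^ minusPart b * 6, by positivity, ?_⟩
    intro t ht
    have h0 : 0 < 1 - t := by linarith [ht.2]
    have h1 : ∫ y in (min (1 - t) 1)..1, y ^ ((0 : ℝ) - 1) ≤ |Real.log (1 - t)| := by
      rw [zero_sub]
      simp only [Real.rpow_neg_one]
      rw [integral_inv (hmem _ h0)]
      rcases min_cases (1 - t) 1 with ⟨e, _⟩ | ⟨e, _⟩ <;> rw [e]
      · rw [one_div, Real.log_inv]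
        exact neg_le_abs _
      · simp
    calc _ ≤ 2 ^ minusPart b / (1 + |Real.log (1 - t)|) *
          (6 * (1 + |Real.log (1 - t)|)) := by
          have := u₂_nonneg 0 b ht
          refine mul_le_mul (u₂_zero_le b ht) ?_ ?_ (by positivity)
          · rw [Real.rpow_zero, zero_add, div_one]; linarith [abs_nonneg (Real.log (1 - t))]
          · have : 0 ≤ ∫ y in (min (1 - t) 1)..1, y ^ ((0 : ℝ) - 1) :=
              intervalIntegral.integral_nonneg (min_le_right _ _) fun y hy =>
                Real.rpow_nonneg ((lt_min h0 one_pos).le.trans hy.1) _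
            positivity
      _ = _ := by field_simp

/-- The contribution of `x > 0` away from `t`. -/
theorem exists_lintegral_right_le {a : ℝ} (b : ℝ) (ha : -1 < a) :
    ∃ K : ℝ, 0 < K ∧ ∀ (Q : ℝ[X]) (N : ℕ) (M : ℝ), 1 ≤ N → Q.natDegree ≤ N →
    (∀ x ∈ Ioo (-1 : ℝ) 1, |Q.eval x| * jacobi (plusPart a) (plusPart b) x ≤ M) →
    ∀ t ∈ Ioo (-1 : ℝ) 1,
      ENNReal.ofReal (u₂ a b t) * (∫⁻ x in Ioo 0 1 ∩ {x | (1 - |t|) / 2 ≤ |x - t|},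
        ‖regKernel a b (fun x => Q.eval x) t x‖ₑ) ≤
        ENNReal.ofReal (K * M * (1 + Real.log N)) := by
  rcases lt_or_ge 0 a with ha0 | ha0
  · exact exists_lintegral_right_le_of_pos b ha0
  obtain ⟨K, hK, h⟩ := exists_u₂_mul_le b ha ha0
  refine ⟨K, hK, ?_⟩
  intro Q N M hN hQ hM t ht
  have hN0 : (1 : ℝ) ≤ N := by exact_mod_cast hN
  have hl : 0 ≤ Real.log N := Real.log_nonneg hN0
  have hM0 : 0 ≤ M := (mul_nonneg (abs_nonneg _) (jacobi_pos _ _ ht).le).trans (hM t ht)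
  have hma : -minusPart a = a := by rw [minusPart, max_eq_right (by linarith), neg_neg]
  have h0 : 0 < 1 - t := by linarith [ht.2]
  have hu := u₂_nonneg a b ht
  calc _ ≤ ENNReal.ofReal (u₂ a b t) * ∫⁻ x in Ioo (0 : ℝ) 1, ENNReal.ofReal M *
        ENNReal.ofReal ((1 - x) ^ a * min (6 / (1 - t)) (3 / (1 - x))) := by
        refine mul_le_mul' le_rfl ?_
        refine (setLIntegral_mono' (measurableSet_Ioo.inter (measurableSet_far t))
          fun x hx => ?_).trans
          (lintegral_mono_set inter_subset_left)
        have h4 : 0 < 1 - x := by linarith [hx.1.2]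
        refine (enorm_regKernel_far_le ht hx.1 hx.2).trans ?_
        rw [← ENNReal.ofReal_mul hM0, ← mul_assoc]
        apply ENNReal.ofReal_le_ofReal
        have := abs_mul_jacobi_le hx.1 hM
        rw [hma] at this
        gcongr
    _ ≤ ENNReal.ofReal (u₂ a b t) * (ENNReal.ofReal M * ENNReal.ofReal (6 / (a + 1) * (1 - t) ^ a +
          3 * ∫ y in (min (1 - t) 1)..1, y ^ (a - 1))) := by
        rw [lintegral_const_mul' _ _ ENNReal.ofReal_ne_top,
          lintegral_one_sub_Ioo (fun y => ENNReal.ofReal (y ^ a * min (6 / (1 - t)) (3 / y)))]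
        gcongr
        exact lintegral_min_le ha h0
    _ = ENNReal.ofReal (M * (u₂ a b t * (6 / (a + 1) * (1 - t) ^ a +
          3 * ∫ y in (min (1 - t) 1)..1, y ^ (a - 1)))) := by
        rw [← ENNReal.ofReal_mul hM0, ← ENNReal.ofReal_mul hu]
        ring_nf
    _ ≤ _ := by
        apply ENNReal.ofReal_le_ofReal
        calc _ ≤ M * K := by gcongr; exact h t ht
          _ ≤ M * K * (1 + Real.log N) := le_mul_of_one_le_right (by positivity) (by linarith)
          _ = _ := by ring

/-! ### Reflection and the bound for polynomials -/

theorem jacobi_neg (a b x : ℝ) : jacobi a b (-x) = jacobi b a x := by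
  simp only [jacobi, sub_neg_eq_add, ← sub_eq_add_neg, mul_comm]

theorem u₂_neg (a b t : ℝ) : u₂ a b (-t) = u₂ b a t := by
  have h1 : uPlus a b 1 = uPlus b a (-1) := by rw [uPlus, uPlus, jacobi_neg]
  have h2 : uMinus a b 1 = uMinus b a (-1) := by rw [uMinus, uMinus, jacobi_neg]
  have h3 : uPlus a b (-1) = uPlus b a 1 := by rw [uPlus, uPlus, jacobi_neg]
  have h4 : uMinus a b (-1) = uMinus b a 1 := by rw [uMinus, uMinus, jacobi_neg]
  have h5 : uMinus a b (-t) = uMinus b a t := by rw [uMinus, uMinus, jacobi_neg]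
  simp only [u₂, h1, h2, h3, h4, h5, sub_neg_eq_add, ← sub_eq_add_neg]
  ring

theorem enorm_regKernel_neg (a b : ℝ) (F : ℝ → ℝ) (t x : ℝ) :
    ‖regKernel a b F t (-x)‖ₑ = ‖regKernel b a (fun x => F (-x)) (-t) x‖ₑ := by
  have h1 : |(-x) - t| = |x - (-t)| := by rw [← abs_neg]; congr 1; ring
  have h2 : (-x) - t = -(x - (-t)) := by ring
  rw [← enorm_neg]
  congr 1
  simp only [regKernel, h1, abs_neg, neg_neg, jacobi_neg]
  rw [h2, div_neg, neg_neg]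

theorem exists_lintegral_left_le (a : ℝ) {b : ℝ} (hb : -1 < b) :
    ∃ K : ℝ, 0 < K ∧ ∀ (Q : ℝ[X]) (N : ℕ) (M : ℝ), 1 ≤ N → Q.natDegree ≤ N →
    (∀ x ∈ Ioo (-1 : ℝ) 1, |Q.eval x| * jacobi (plusPart a) (plusPart b) x ≤ M) →
    ∀ t ∈ Ioo (-1 : ℝ) 1,
      ENNReal.ofReal (u₂ a b t) * (∫⁻ x in Ioo (-1) 0 ∩ {x | (1 - |t|) / 2 ≤ |x - t|},
        ‖regKernel a b (fun x => Q.eval x) t x‖ₑ) ≤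
        ENNReal.ofReal (K * M * (1 + Real.log N)) := by
  obtain ⟨K, hK, h⟩ := exists_lintegral_right_le a hb
  refine ⟨K, hK, ?_⟩
  intro Q N M hN hQ hM t ht
  have := h (Q.comp (-X)) N M hN ?_ ?_ (-t) ⟨by linarith [ht.2], by linarith [ht.1]⟩
  · refine le_trans (le_of_eq ?_) this
    rw [u₂_neg]
    congr 1
    rw [← (Measure.measurePreserving_neg (volume : Measure ℝ)).setLIntegral_comp_preimage_emb
      (MeasurableEquiv.neg ℝ).measurableEmbedding]
    have hset : Neg.neg ⁻¹' (Ioo (-1 : ℝ) 0 ∩ {x | (1 - |t|) / 2 ≤ |x - t|}) =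
        Ioo 0 1 ∩ {x | (1 - |-t|) / 2 ≤ |x - -t|} := by
      ext x
      have h1 : |(-x) - t| = |x - (-t)| := by rw [← abs_neg]; congr 1; ring
      simp only [mem_preimage, mem_inter_iff, mem_Ioo, mem_ofPred_eq, h1, abs_neg]
      constructor <;> rintro ⟨⟨h2, h3⟩, h4⟩ <;> refine ⟨⟨?_, ?_⟩, h4⟩ <;> linarith
    rw [hset]
    refine lintegral_congr fun x => ?_
    rw [enorm_regKernel_neg]
    simp
  · refine natDegree_comp_le.trans ?_
    simpa using hQ
  · intro x hx
    have := hM (-x) ⟨by linarith [hx.2], by linarith [hx.1]⟩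
    rw [jacobi_neg] at this
    simpa using this

/-- The regularized Hilbert transform of a polynomial `Q` of degree at most `N` with
`‖Q u₊‖_∞ ≤ M` is bounded by `M log N`, after multiplication by `u₂`. -/
theorem exists_lintegral_regKernel_polynomial_le {a b : ℝ} (ha : -1 < a) (hb : -1 < b) :
    ∃ K : ℝ, 0 < K ∧ ∀ (Q : ℝ[X]) (N : ℕ) (M : ℝ), 1 ≤ N → Q.natDegree ≤ N →
    (∀ x ∈ Ioo (-1 : ℝ) 1, |Q.eval x| * jacobi (plusPart a) (plusPart b) x ≤ M) →
    ∀ t ∈ Ioo (-1 : ℝ) 1,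
      ENNReal.ofReal (u₂ a b t) * (∫⁻ x in Ioo (-1) 1,
        ‖regKernel a b (fun x => Q.eval x) t x‖ₑ) ≤
        ENNReal.ofReal (K * M * (1 + Real.log N)) := by
  obtain ⟨K₁, hK₁, h1⟩ := exists_lintegral_near_le a b
  obtain ⟨K₂, hK₂, h2⟩ := exists_lintegral_right_le b ha
  obtain ⟨K₃, hK₃, h3⟩ := exists_lintegral_left_le a hb
  refine ⟨K₁ + K₃ + K₂, by positivity, ?_⟩
  intro Q N M hN hQ hM t ht
  have hN0 : (1 : ℝ) ≤ N := by exact_mod_cast hN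
  have hl : 0 ≤ Real.log N := Real.log_nonneg hN0
  have hM0 : 0 ≤ M := (mul_nonneg (abs_nonneg _) (jacobi_pos _ _ ht).le).trans (hM t ht)
  set d := (1 - |t|) / 2 with hd
  have hsub : Ioo (-1 : ℝ) 1 ⊆ ((Ioo (t - d) (t + d) ∪ (Ioo (-1) 0 ∩ {x | d ≤ |x - t|})) ∪
      (Ioo 0 1 ∩ {x | d ≤ |x - t|})) ∪ {0} := by
    intro x hx
    rcases lt_or_ge |x - t| d with h | h
    · refine Or.inl (Or.inl (Or.inl ?_))
      have := abs_lt.1 h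
      constructor <;> linarith
    · rcases lt_trichotomy x 0 with h0 | h0 | h0
      · exact Or.inl (Or.inl (Or.inr ⟨⟨hx.1, h0⟩, h⟩))
      · exact Or.inr h0
      · exact Or.inl (Or.inr ⟨⟨h0, hx.2⟩, h⟩)
  set g : ℝ → ℝ≥0∞ := fun x => ‖regKernel a b (fun x => Q.eval x) t x‖ₑ with hg
  have hle : ∫⁻ x in Ioo (-1 : ℝ) 1, g x ≤ (∫⁻ x in Ioo (t - d) (t + d), g x) +
      (∫⁻ x in Ioo (-1) 0 ∩ {x | d ≤ |x - t|}, g x) +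
      ∫⁻ x in Ioo 0 1 ∩ {x | d ≤ |x - t|}, g x := by
    refine (lintegral_mono_set hsub).trans ?_
    refine (lintegral_union_le _ _ _).trans ?_
    rw [Measure.restrict_singleton, Real.volume_singleton, zero_smul, lintegral_zero_measure,
      add_zero]
    refine (lintegral_union_le _ _ _).trans ?_
    gcongr
    exact lintegral_union_le _ _ _
  have hnear := h1 Q N M hN hQ hM t ht
  calc _ ≤ ENNReal.ofReal (u₂ a b t) * ((∫⁻ x in Ioo (t - d) (t + d), g x) +
      (∫⁻ x in Ioo (-1) 0 ∩ {x | d ≤ |x - t|}, g x) +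
      ∫⁻ x in Ioo 0 1 ∩ {x | d ≤ |x - t|}, g x) := by gcongr
    _ ≤ ENNReal.ofReal (K₁ * M * (1 + Real.log N)) + ENNReal.ofReal (K₃ * M * (1 + Real.log N)) +
        ENNReal.ofReal (K₂ * M * (1 + Real.log N)) := by
        rw [mul_add, mul_add]
        refine add_le_add (add_le_add ?_ (h3 Q N M hN hQ hM t ht)) (h2 Q N M hN hQ hM t ht)
        refine le_trans ?_ hnear
        gcongr
        exact u₂_le_uMinus a b ht
    _ = _ := by
        rw [← ENNReal.ofReal_add (by positivity) (by positivity),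
          ← ENNReal.ofReal_add (by positivity) (by positivity)]
        congr 1
        ring

/-! ### Weighted norms and best approximation -/

theorem le_wSupNorm (γ δ : ℝ) (f : ℝ → ℝ) {x : ℝ} (hx : x ∈ Ioo (-1 : ℝ) 1) :
    ENNReal.ofReal (|f x| * jacobi γ δ x) ≤ wSupNorm γ δ f :=
  le_iSup₂ (f := fun x (_ : x ∈ Ioo (-1 : ℝ) 1) => ENNReal.ofReal (|f x| * jacobi γ δ x)) x hx

theorem abs_mul_le_toReal_wSupNorm {γ δ : ℝ} {f : ℝ → ℝ} (hf : wSupNorm γ δ f ≠ ∞) {x : ℝ}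
    (hx : x ∈ Ioo (-1 : ℝ) 1) : |f x| * jacobi γ δ x ≤ (wSupNorm γ δ f).toReal :=
  (ENNReal.ofReal_le_iff_le_toReal hf).1 (le_wSupNorm γ δ f hx)

theorem wSupNorm_sub_le (γ δ : ℝ) (f g h : ℝ → ℝ) :
    wSupNorm γ δ (fun x => f x - g x) ≤
      wSupNorm γ δ (fun x => h x - g x) + wSupNorm γ δ (fun x => h x - f x) := by
  refine iSup₂_le fun x hx => ?_
  refine le_trans ?_ (add_le_add (le_wSupNorm γ δ (fun x => h x - g x) hx)
    (le_wSupNorm γ δ (fun x => h x - f x) hx))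
  have hj := jacobi_pos γ δ hx
  rw [← ENNReal.ofReal_add (by positivity) (by positivity), ← add_mul]
  apply ENNReal.ofReal_le_ofReal
  gcongr
  calc |f x - g x| = |(h x - g x) - (h x - f x)| := by congr 1; ring
    _ ≤ _ := abs_sub _ _

theorem bestApprox_le {γ δ : ℝ} {n : ℕ} (f : ℝ → ℝ) {P : ℝ[X]} (hP : P.natDegree ≤ n) :
    bestApprox γ δ n f ≤ wSupNorm γ δ (fun x => f x - P.eval x) :=
  iInf₂_le P hP

theorem bestApprox_le_wSupNorm (γ δ : ℝ) (n : ℕ) (f : ℝ → ℝ) :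
    bestApprox γ δ n f ≤ wSupNorm γ δ f := by
  simpa using bestApprox_le (γ := γ) (δ := δ) f (P := 0) (n := n) (by simp)

theorem bestApprox_antitone (γ δ : ℝ) (f : ℝ → ℝ) : Antitone fun n => bestApprox γ δ n f :=
  fun _ _ hmn => le_iInf₂ fun _ hP => bestApprox_le f (hP.trans hmn)

/-- A nearly best approximation, with an error term relative to the norm of `f`. -/
theorem exists_polynomial_le {γ δ : ℝ} {f : ℝ → ℝ} (hf : wSupNorm γ δ f ≠ ∞) (n : ℕ) {η : ℝ≥0∞}
    (hη : η ≠ 0) : ∃ P : ℝ[X], P.natDegree ≤ n ∧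
      wSupNorm γ δ (fun x => f x - P.eval x) ≤ bestApprox γ δ n f + η * wSupNorm γ δ f := by
  by_cases h0 : wSupNorm γ δ f = 0
  · exact ⟨0, by simp, by simp [h0]⟩
  · have h1 : bestApprox γ δ n f < bestApprox γ δ n f + η * wSupNorm γ δ f :=
      ENNReal.lt_add_right ((bestApprox_le_wSupNorm γ δ n f).trans_lt hf.lt_top).ne
        (mul_ne_zero hη h0)
    obtain ⟨P, hP⟩ := iInf_lt_iff.1 h1
    obtain ⟨hP1, hP2⟩ := iInf_lt_iff.1 hP
    exact ⟨P, hP1, hP2.le⟩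

theorem MemC0.wSupNorm_ne_top {γ δ : ℝ} {f : ℝ → ℝ} (hf : MemC0 γ δ f) :
    wSupNorm γ δ f ≠ ∞ := by
  obtain ⟨hc, ⟨l, hl, -⟩, ⟨l', hl', -⟩⟩ := hf
  have hj : ContinuousOn (jacobi γ δ) (Ioo (-1) 1) := by
    refine ContinuousOn.mul ?_ ?_
    · refine ContinuousOn.rpow_const (by fun_prop) fun x hx => Or.inl ?_
      linarith [hx.2]
    · refine ContinuousOn.rpow_const (by fun_prop) fun x hx => Or.inl ?_
      linarith [hx.1]
  have h1 := continuousOn_Icc_extendFrom_Ioo (hc.mul hj) hl' hl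
  obtain ⟨C, hC⟩ := isCompact_Icc.exists_bound_of_continuousOn h1
  refine ne_top_of_le_ne_top (ENNReal.ofReal_ne_top (r := C)) (iSup₂_le fun x hx => ?_)
  apply ENNReal.ofReal_le_ofReal
  have h2 := hC x ⟨hx.1.le, hx.2.le⟩
  have h3 : extendFrom (Ioo (-1 : ℝ) 1) (fun x => f x * jacobi γ δ x) x = f x * jacobi γ δ x := by
    refine extendFrom_eq (subset_closure hx) ?_
    exact ((hc.mul hj) x hx).tendsto
  have h2' : ‖f x * jacobi γ δ x‖ ≤ C := by rw [← h3]; exact h2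
  rwa [norm_mul, Real.norm_eq_abs, Real.norm_eq_abs, abs_of_pos (jacobi_pos γ δ hx)] at h2'

/-! ### Condensation of the Besov sum -/

theorem tsum_bestApprox_div (γ δ : ℝ) (f : ℝ → ℝ) :
    ∑' n : ℕ, bestApprox γ δ n f / ((n : ℝ≥0∞) + 1) = bestApprox γ δ 0 f + besovSum γ δ f := by
  rw [tsum_eq_zero_add' ENNReal.summable, besovSum]
  congr 1
  · simp
  · refine tsum_congr fun n => ?_
    congr 1
    push_cast
    rw [add_assoc, one_add_one_eq_two]

/-- Two condensations: `∑_j 2^j E_{N_j}` over the superexponential sequence `N_j = 2^{2^j}` is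
controlled by `∑_n E_n / (n + 1)`. -/
theorem tsum_two_pow_mul_bestApprox_le (γ δ : ℝ) (f : ℝ → ℝ) :
    ∑' j : ℕ, 2 ^ j * bestApprox γ δ (2 ^ 2 ^ j) f ≤
      13 * wSupNorm γ δ f + 8 * besovSum γ δ f := by
  set E : ℕ → ℝ≥0∞ := fun n => bestApprox γ δ n f with hE
  have hanti : Antitone E := bestApprox_antitone γ δ f
  have hS : ∀ n, E n ≤ wSupNorm γ δ f := fun n => bestApprox_le_wSupNorm γ δ n f
  have h1 : ∑' j : ℕ, 2 ^ j * E (2 ^ 2 ^ j) ≤ E (2 ^ 1) + 2 * ∑' k, E (2 ^ k) :=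
    ENNReal.tsum_condensed_le (f := fun k => E (2 ^ k))
      fun m n _ hmn => hanti (Nat.pow_le_pow_right (by norm_num) hmn)
  have h2 : ∑' k : ℕ, 2 ^ k * (E (2 ^ k) / ((2 ^ k : ℕ) + 1 : ℝ≥0∞)) ≤
      E 1 / ((1 : ℕ) + 1) + 2 * ∑' n : ℕ, E n / ((n : ℝ≥0∞) + 1) :=
    ENNReal.tsum_condensed_le (f := fun n => E n / ((n : ℝ≥0∞) + 1)) fun m n _ hmn => by
      refine ENNReal.div_le_div (hanti hmn) ?_
      gcongr
  have h3 := tsum_bestApprox_div γ δ f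
  have h4 : ∑' k, E (2 ^ k) ≤ 2 * ∑' k : ℕ, 2 ^ k * (E (2 ^ k) / ((2 ^ k : ℕ) + 1 : ℝ≥0∞)) := by
    rw [← ENNReal.tsum_mul_left]
    refine ENNReal.tsum_le_tsum fun k => ?_
    have h5 : ((2 ^ k : ℕ) + 1 : ℝ≥0∞) ≤ 2 * 2 ^ k := by
      rw [two_mul]; push_cast; gcongr; exact one_le_pow₀ (by norm_num)
    rw [← mul_assoc, mul_div_assoc',
      ENNReal.le_div_iff_mul_le (Or.inl (by simp)) (Or.inl (by simp)), mul_comm]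
    gcongr
  have h6 : E 1 / ((1 : ℕ) + 1) ≤ wSupNorm γ δ f := by
    refine (ENNReal.div_le_of_le_mul ?_)
    calc E 1 ≤ wSupNorm γ δ f * 1 := by rw [mul_one]; exact hS 1
      _ ≤ _ := by gcongr; simp
  calc _ ≤ E (2 ^ 1) + 2 * ∑' k, E (2 ^ k) := h1
    _ ≤ wSupNorm γ δ f + 2 * (2 * (wSupNorm γ δ f + 2 * (wSupNorm γ δ f + besovSum γ δ f))) := by
        gcongr
        · exact hS _
        · refine h4.trans ?_
          gcongr
          refine h2.trans ?_
          rw [h3]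
          gcongr
          exact hS 0
    _ = _ := by ring

/-! ### Continuity of the Hilbert transform on `B₀` -/

theorem measurable_jacobi (a b : ℝ) : Measurable (jacobi a b) := by
  unfold jacobi
  fun_prop

theorem measurable_regKernel {a b t : ℝ} {F : ℝ → ℝ} (hF : Measurable F) :
    Measurable (regKernel a b F t) := by
  refine Measurable.div (Measurable.sub (hF.mul (measurable_jacobi a b))
    (Measurable.ite ?_ measurable_const measurable_const)) (by fun_prop)
  exact measurableSet_lt (by fun_prop) measurable_const

theorem aestronglyMeasurable_regKernel {a b t : ℝ} {F : ℝ → ℝ}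
    (hF : ContinuousOn F (Ioo (-1) 1)) :
    AEStronglyMeasurable (regKernel a b F t) (volume.restrict (Ioo (-1) 1)) := by
  have h1 : AEMeasurable F (volume.restrict (Ioo (-1) 1)) := hF.aemeasurable measurableSet_Ioo
  refine AEMeasurable.aestronglyMeasurable (AEMeasurable.div (AEMeasurable.sub
    (h1.mul (measurable_jacobi a b).aemeasurable) (Measurable.aemeasurable
    (Measurable.ite ?_ measurable_const measurable_const))) (by fun_prop))
  exact measurableSet_lt (by fun_prop) measurable_const

theorem regKernel_sub (a b : ℝ) (F G : ℝ → ℝ) (t x : ℝ) :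
    regKernel a b (fun x => F x - G x) t x = regKernel a b F t x - regKernel a b G t x := by
  simp only [regKernel]
  rw [← sub_div]
  congr 1
  split_ifs <;> ring

/-- The bound of the regularized Hilbert transform of `F ∈ B₀(u₊)`: it is the sum of the bounds for
the blocks `P_{j+1} - P_j`, `P_j` being a nearly best approximation of degree `2^{2^j}`. The factor
`log N` of the bound for polynomials turns into `2^j`. -/
theorem exists_lintegral_regKernel_le {a b : ℝ} (ha : -1 < a) (hb : -1 < b) :
    ∃ K : ℝ, 0 < K ∧ ∀ F : ℝ → ℝ, MemB0 (plusPart a) (plusPart b) F → ∀ t ∈ Ioo (-1 : ℝ) 1,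
      ENNReal.ofReal (u₂ a b t) * (∫⁻ x in Ioo (-1) 1, ‖regKernel a b F t x‖ₑ) ≤
        ENNReal.ofReal K * (wSupNorm (plusPart a) (plusPart b) F +
          besovSum (plusPart a) (plusPart b) F) := by
  obtain ⟨K, hK, hpoly⟩ := exists_lintegral_regKernel_polynomial_le ha hb
  refine ⟨K * 96, by positivity, ?_⟩
  intro F hF t ht
  set A := plusPart a
  set B := plusPart b
  set S := wSupNorm A B F with hS
  have hS0 : S ≠ ∞ := hF.1.wSupNorm_ne_top
  have hpoly' : ∀ (Q : ℝ[X]) (N : ℕ), 1 ≤ N → Q.natDegree ≤ N →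
      ENNReal.ofReal (u₂ a b t) * (∫⁻ x in Ioo (-1) 1, ‖regKernel a b (fun x => Q.eval x) t x‖ₑ) ≤
        ENNReal.ofReal (K * (1 + Real.log N)) * wSupNorm A B (fun x => Q.eval x) := by
    intro Q N hN hQ
    have hl : 0 ≤ Real.log N := Real.log_nonneg (by exact_mod_cast hN)
    by_cases htop : wSupNorm A B (fun x => Q.eval x) = ∞
    · rw [htop, ENNReal.mul_top (by simpa using by positivity)]
      exact le_top
    · refine (hpoly Q N _ hN hQ (fun x hx => abs_mul_le_toReal_wSupNorm htop hx) t ht).trans ?_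
      rw [mul_right_comm, ENNReal.ofReal_mul (by positivity), ENNReal.ofReal_toReal htop]
  choose P hPdeg hP using fun j : ℕ =>
    exists_polynomial_le (γ := A) (δ := B) hS0 (2 ^ 2 ^ j) (η := 4⁻¹ ^ j) (by simp)
  set e : ℕ → ℝ≥0∞ := fun j => bestApprox A B (2 ^ 2 ^ j) F + 4⁻¹ ^ j * S with he
  have hsum : ∑' j, 2 ^ j * e j ≤ 15 * S + 8 * besovSum A B F := by
    have h1 : ∑' j : ℕ, (2 : ℝ≥0∞) ^ j * (4⁻¹ ^ j * S) = 2 * S := by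
      have : ∀ j : ℕ, (2 : ℝ≥0∞) ^ j * (4⁻¹ ^ j * S) = 2⁻¹ ^ j * S := by
        intro j
        rw [← mul_assoc, ← mul_pow]
        congr 2
        rw [show (4 : ℝ≥0∞) = 2 * 2 by norm_num, ENNReal.mul_inv (by simp) (by simp), ← mul_assoc,
          ENNReal.mul_inv_cancel (by simp) (by simp), one_mul]
      simp only [this]
      rw [ENNReal.tsum_mul_right, ENNReal.tsum_geometric, ENNReal.one_sub_inv_two, inv_inv]
    simp only [he, mul_add]
    rw [ENNReal.tsum_add, h1]
    calc _ ≤ (13 * S + 8 * besovSum A B F) + 2 * S := by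
          gcongr; exact tsum_two_pow_mul_bestApprox_le A B F
      _ = _ := by ring
  have hsum' : ∑' j, 2 ^ j * e j ≠ ∞ := by
    refine ne_top_of_le_ne_top ?_ hsum
    exact ENNReal.add_ne_top.2 ⟨ENNReal.mul_ne_top (by simp) hS0,
      ENNReal.mul_ne_top (by simp) hF.2.ne⟩
  have he0 : Tendsto e atTop (𝓝 0) := by
    refine tendsto_of_tendsto_of_tendsto_of_le_of_le tendsto_const_nhds
      (ENNReal.tendsto_atTop_zero_of_tsum_ne_top hsum') (fun _ => zero_le) fun j => ?_
    exact le_mul_of_one_le_left' (one_le_pow₀ (by norm_num))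
  have heanti : ∀ j, e (j + 1) ≤ e j := by
    intro j
    simp only [he]
    gcongr ?_ + ?_ * S
    · exact bestApprox_antitone A B F
        (Nat.pow_le_pow_right (by norm_num) (Nat.pow_le_pow_right (by norm_num) (by omega)))
    · exact pow_le_pow_of_le_one (by simp) (ENNReal.inv_le_one.2 (by norm_num)) (by omega)
  have hlim : ∀ x ∈ Ioo (-1 : ℝ) 1, Tendsto (fun j => (P j).eval x) atTop (𝓝 (F x)) := by
    intro x hx
    have hj := jacobi_pos A B hx
    have h1 : Tendsto (fun j => ENNReal.ofReal (|F x - (P j).eval x| * jacobi A B x)) atTop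
        (𝓝 0) :=
      tendsto_of_tendsto_of_tendsto_of_le_of_le tendsto_const_nhds he0 (fun _ => zero_le)
        fun j => (le_wSupNorm A B (fun x => F x - (P j).eval x) hx).trans (hP j)
    have h2 := (ENNReal.tendsto_toReal ENNReal.zero_ne_top).comp h1
    have h3 : Tendsto (fun j => |F x - (P j).eval x|) atTop (𝓝 0) := by
      have h4 := h2.div_const (jacobi A B x)
      rw [ENNReal.toReal_zero, zero_div] at h4
      refine h4.congr fun j => ?_
      simp only [Function.comp_apply]
      rw [ENNReal.toReal_ofReal (by positivity), mul_div_cancel_right₀ _ hj.ne']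
    have h5 : Tendsto (fun j => F x - (P j).eval x) atTop (𝓝 0) :=
      (tendsto_zero_iff_abs_tendsto_zero _).2 h3
    simpa using h5.const_sub (F x)
  set Q : ℕ → ℝ[X] := fun j => P (j + 1) - P j with hQ
  have hpt : ∀ x ∈ Ioo (-1 : ℝ) 1, ‖regKernel a b F t x‖ₑ ≤
      ‖regKernel a b (fun x => (P 0).eval x) t x‖ₑ +
        ∑' j, ‖regKernel a b (fun x => (Q j).eval x) t x‖ₑ := by
    intro x hx
    have h1 : Tendsto (fun j => regKernel a b (fun x => (P j).eval x) t x) atTop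
        (𝓝 (regKernel a b F t x)) := by
      simp only [regKernel]
      refine Tendsto.div_const (((hlim x hx).mul_const _).sub ?_) _
      split_ifs
      · exact (hlim t ht).mul_const _
      · exact tendsto_const_nhds
    refine le_of_tendsto h1.enorm (Eventually.of_forall fun J => ?_)
    have h2 : regKernel a b (fun x => (P J).eval x) t x =
        regKernel a b (fun x => (P 0).eval x) t x +
          ∑ j ∈ Finset.range J, regKernel a b (fun x => (Q j).eval x) t x := by
      have : ∀ j, regKernel a b (fun x => (Q j).eval x) t x =
          regKernel a b (fun x => (P (j + 1)).eval x) t x -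
            regKernel a b (fun x => (P j).eval x) t x := by
        intro j
        rw [← regKernel_sub]
        simp [hQ]
      simp only [this]
      rw [Finset.sum_range_sub (fun j => regKernel a b (fun x => (P j).eval x) t x)]
      ring
    rw [h2]
    refine (enorm_add_le _ _).trans (add_le_add_right ((enorm_sum_le _ _).trans ?_) _)
    exact ENNReal.sum_le_tsum _
  have hmeas : ∀ R : ℝ[X], Measurable fun x => ‖regKernel a b (fun x => R.eval x) t x‖ₑ :=
    fun R => (measurable_regKernel R.continuous.measurable).enorm
  have hP0 : wSupNorm A B (fun x => (P 0).eval x) ≤ 3 * S := by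
    have h1 := wSupNorm_sub_le A B (fun x => (P 0).eval x) (fun _ => 0) F
    simp only [sub_zero] at h1
    refine h1.trans ?_
    calc _ ≤ S + (S + S) := by
          gcongr
          refine (hP 0).trans ?_
          rw [pow_zero (4⁻¹ : ℝ≥0∞), one_mul]
          exact add_le_add_left (bestApprox_le_wSupNorm A B _ F) S
      _ = _ := by ring
  have hQn : ∀ j, wSupNorm A B (fun x => (Q j).eval x) ≤ 2 * e j := by
    intro j
    simp only [hQ, eval_sub]
    refine (wSupNorm_sub_le A B (fun x => (P (j + 1)).eval x) (fun x => (P j).eval x) F).trans ?_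
    rw [two_mul]
    exact add_le_add (hP j) ((hP (j + 1)).trans (heanti j))
  have hlog2 : Real.log 2 ≤ 1 := by linarith [Real.log_two_lt_d9]
  have hb0 : ENNReal.ofReal (u₂ a b t) *
      (∫⁻ x in Ioo (-1) 1, ‖regKernel a b (fun x => (P 0).eval x) t x‖ₑ) ≤
        ENNReal.ofReal K * (6 * S) := by
    refine (hpoly' (P 0) 2 (by norm_num) (by simpa using hPdeg 0)).trans ?_
    rw [ENNReal.ofReal_mul hK.le, mul_assoc]
    refine mul_le_mul' le_rfl ?_
    calc _ ≤ 2 * (3 * S) := by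
          refine mul_le_mul' ?_ hP0
          rw [← ENNReal.ofReal_ofNat 2]
          apply ENNReal.ofReal_le_ofReal
          push_cast
          linarith
      _ = _ := by ring
  have hbj : ∀ j, ENNReal.ofReal (u₂ a b t) *
      (∫⁻ x in Ioo (-1) 1, ‖regKernel a b (fun x => (Q j).eval x) t x‖ₑ) ≤
        ENNReal.ofReal K * (6 * (2 ^ j * e j)) := by
    intro j
    have hd : (Q j).natDegree ≤ 2 ^ 2 ^ (j + 1) := by
      refine (natDegree_sub_le _ _).trans (max_le (hPdeg (j + 1)) ((hPdeg j).trans ?_))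
      exact Nat.pow_le_pow_right (by norm_num) (Nat.pow_le_pow_right (by norm_num) (by omega))
    refine (hpoly' (Q j) _ Nat.one_le_two_pow hd).trans ?_
    rw [ENNReal.ofReal_mul hK.le, mul_assoc]
    refine mul_le_mul' le_rfl ?_
    calc _ ≤ (3 * 2 ^ j) * (2 * e j) := by
          refine mul_le_mul' ?_ (hQn j)
          · have h1 : (3 * 2 ^ j : ℝ≥0∞) = ENNReal.ofReal (3 * 2 ^ j) := by
              rw [ENNReal.ofReal_mul (by norm_num), ENNReal.ofReal_pow (by norm_num)]
              simp
            rw [h1]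
            apply ENNReal.ofReal_le_ofReal
            push_cast
            rw [Real.log_pow]
            push_cast
            have h2 : (1 : ℝ) ≤ 2 ^ j := one_le_pow₀ (by norm_num)
            have h3 : (2 : ℝ) ^ (j + 1) * Real.log 2 ≤ 2 ^ (j + 1) * 1 := by gcongr
            rw [pow_succ] at h3 ⊢
            linarith
      _ = _ := by ring
  calc _ ≤ ENNReal.ofReal (u₂ a b t) * (∫⁻ x in Ioo (-1) 1,
          (‖regKernel a b (fun x => (P 0).eval x) t x‖ₑ +
            ∑' j, ‖regKernel a b (fun x => (Q j).eval x) t x‖ₑ)) :=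
        mul_le_mul' le_rfl (setLIntegral_mono' measurableSet_Ioo hpt)
    _ = ENNReal.ofReal (u₂ a b t) *
          (∫⁻ x in Ioo (-1) 1, ‖regKernel a b (fun x => (P 0).eval x) t x‖ₑ) +
        ∑' j, ENNReal.ofReal (u₂ a b t) *
          (∫⁻ x in Ioo (-1) 1, ‖regKernel a b (fun x => (Q j).eval x) t x‖ₑ) := by
        rw [lintegral_add_left (hmeas _), lintegral_tsum fun j => (hmeas _).aemeasurable, mul_add,
          ENNReal.tsum_mul_left]
    _ ≤ ENNReal.ofReal K * (6 * S) + ∑' j, ENNReal.ofReal K * (6 * (2 ^ j * e j)) :=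
        add_le_add hb0 (ENNReal.tsum_le_tsum hbj)
    _ ≤ ENNReal.ofReal K * (6 * S) +
        ENNReal.ofReal K * (6 * (15 * S + 8 * besovSum A B F)) := by
        rw [ENNReal.tsum_mul_left, ENNReal.tsum_mul_left]
        gcongr
    _ = ENNReal.ofReal K * (96 * S + 48 * besovSum A B F) := by ring
    _ ≤ ENNReal.ofReal K * (96 * S + 96 * besovSum A B F) := by
        gcongr; norm_num
    _ = _ := by
        rw [ENNReal.ofReal_mul hK.le, ← mul_add, mul_assoc]
        simp

/-- For `F ∈ B₀(u₊)` the finite Hilbert transform exists on `(-1, 1)`, and `|ℋF| u₂` is bounded by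
the norm of `F` in `B₀(u₊)`. -/
theorem exists_hilbert_le {a b : ℝ} (ha : -1 < a) (hb : -1 < b) :
    ∃ K : ℝ, 0 < K ∧ ∀ F : ℝ → ℝ, MemB0 (plusPart a) (plusPart b) F → ∀ t ∈ Ioo (-1 : ℝ) 1,
      HilbertExists a b F t ∧
      |hilbert a b F t| * u₂ a b t ≤ K * normB0 (plusPart a) (plusPart b) F := by
  obtain ⟨K, hK, h⟩ := exists_lintegral_regKernel_le ha hb
  refine ⟨K, hK, fun F hF t ht => ?_⟩
  have h1 := h F hF t ht
  have hfin : wSupNorm (plusPart a) (plusPart b) F + besovSum (plusPart a) (plusPart b) F ≠ ∞ :=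
    ENNReal.add_ne_top.2 ⟨hF.1.wSupNorm_ne_top, hF.2.ne⟩
  have hu : 0 < u₂ a b t := by
    obtain ⟨h1, h2⟩ := endpoint_coeff_nonneg a b
    have := uMinus_pos a b ht
    rw [u₂]
    positivity
  have hR : ENNReal.ofReal K * (wSupNorm (plusPart a) (plusPart b) F +
      besovSum (plusPart a) (plusPart b) F) ≠ ∞ := ENNReal.mul_ne_top ENNReal.ofReal_ne_top hfin
  have hint : ∫⁻ x in Ioo (-1) 1, ‖regKernel a b F t x‖ₑ ≠ ∞ := by
    intro htop
    rw [htop, ENNReal.mul_top (by simpa using hu)] at h1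
    exact hR (top_le_iff.1 h1)
  have hi : IntegrableOn (regKernel a b F t) (Ioo (-1) 1) :=
    ⟨aestronglyMeasurable_regKernel hF.1.1, hint.lt_top⟩
  obtain ⟨hex, hval⟩ := hilbertExists_of_integrable ht hi
  refine ⟨hex, ?_⟩
  have h2 : |hilbert a b F t| ≤ (∫⁻ x in Ioo (-1) 1, ‖regKernel a b F t x‖ₑ).toReal := by
    rw [hval, ← Real.norm_eq_abs]
    refine (norm_integral_le_integral_norm _).trans (le_of_eq ?_)
    rw [integral_norm_eq_lintegral_enorm hi.aestronglyMeasurable]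
  have h3 := ENNReal.toReal_mono hR h1
  rw [ENNReal.toReal_mul, ENNReal.toReal_mul, ENNReal.toReal_ofReal hu.le,
    ENNReal.toReal_ofReal hK.le] at h3
  calc _ ≤ (∫⁻ x in Ioo (-1) 1, ‖regKernel a b F t x‖ₑ).toReal * u₂ a b t := by gcongr
    _ ≤ _ := by rw [mul_comm]; exact h3

/-! ### The orthogonality functional -/

theorem integrableOn_jacobi_right {α : ℝ} (β : ℝ) (hα : -1 < α) :
    IntegrableOn (jacobi α β) (Icc 0 1) := by
  have h1 : IntegrableOn (fun x : ℝ => (1 - x) ^ α) (Icc 0 1) := by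
    have h := (intervalIntegral.intervalIntegrable_rpow' (a := 0) (b := 1) hα).comp_sub_left 1
    simp only [sub_zero, sub_self] at h
    exact (intervalIntegrable_iff_integrableOn_Icc_of_le zero_le_one).1 h.symm
  refine h1.mul_continuousOn ?_ isCompact_Icc
  refine ContinuousOn.rpow_const (by fun_prop) fun x hx => Or.inl ?_
  linarith [hx.1]

theorem integrableOn_jacobi {α β : ℝ} (hα : -1 < α) (hβ : -1 < β) :
    IntegrableOn (jacobi α β) (Icc (-1) 1) := by
  have h1 : IntegrableOn (jacobi α β) (Icc (-1) 0) := by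
    rw [← (Measure.measurePreserving_neg (volume : Measure ℝ)).integrableOn_comp_preimage
      (MeasurableEquiv.neg ℝ).measurableEmbedding]
    have e1 : jacobi α β ∘ Neg.neg = jacobi β α := by ext x; exact jacobi_neg α β x
    have e2 : Neg.neg ⁻¹' Icc (-1 : ℝ) 0 = Icc 0 1 := by ext x; simp
    rw [e1, e2]
    exact integrableOn_jacobi_right α hβ
  have := h1.union (integrableOn_jacobi_right β hα)
  rwa [Icc_union_Icc_eq_Icc (by norm_num) (by norm_num)] at this

theorem integrableOn_eval_mul_jacobi {α β : ℝ} (hα : -1 < α) (hβ : -1 < β) (P : ℝ[X]) :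
    IntegrableOn (fun x => P.eval x * jacobi α β x) (Ioo (-1) 1) :=
  ((integrableOn_jacobi hα hβ).continuousOn_mul P.continuous.continuousOn isCompact_Icc).mono_set
    Ioo_subset_Icc_self

/-- The linear functional `P ↦ ∫_{-1}^1 P w` on polynomials, `w = v^{α,β}`. -/
noncomputable def wFunctional {α β : ℝ} (hα : -1 < α) (hβ : -1 < β) : ℝ[X] →ₗ[ℝ] ℝ where
  toFun P := ∫ x in Ioo (-1 : ℝ) 1, P.eval x * jacobi α β x
  map_add' P Q := by
    rw [← integral_add (integrableOn_eval_mul_jacobi hα hβ P)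
      (integrableOn_eval_mul_jacobi hα hβ Q)]
    simp only [eval_add, add_mul]
  map_smul' c P := by
    rw [RingHom.id_apply, smul_eq_mul, ← integral_const_mul]
    simp only [eval_smul, smul_eq_mul, mul_assoc]

theorem wInner_eq {α β : ℝ} (hα : -1 < α) (hβ : -1 < β)
    (P Q : ℝ[X]) : wInner α β P Q = wFunctional hα hβ (P * Q) := by
  simp [wInner, wFunctional]

theorem wFunctional_C_mul {α β : ℝ} (hα : -1 < α) (hβ : -1 < β) (c : ℝ) (P : ℝ[X]) :
    wFunctional hα hβ (C c * P) = c * wFunctional hα hβ P := by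
  rw [← smul_eq_C_mul, map_smul, smul_eq_mul]

theorem wFunctional_pos {α β : ℝ} (hα : -1 < α) (hβ : -1 < β)
    {P : ℝ[X]} (hP : P ≠ 0) (hnn : ∀ x, 0 ≤ P.eval x) :
    0 < wFunctional hα hβ P := by
  have hint := integrableOn_eval_mul_jacobi hα hβ P
  change 0 < ∫ x in Ioo (-1 : ℝ) 1, P.eval x * jacobi α β x
  rw [setIntegral_pos_iff_support_of_nonneg_ae ?_ hint]
  · have hsub : Ioo (-1 : ℝ) 1 \ (P.roots.toFinset : Set ℝ) ⊆
        Function.support (fun x => P.eval x * jacobi α β x) ∩ Ioo (-1) 1 := by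
      rintro x ⟨hx, hr⟩
      refine ⟨?_, hx⟩
      have : P.eval x ≠ 0 := by simpa [hP] using hr
      exact mul_ne_zero this (jacobi_pos α β hx).ne'
    refine lt_of_lt_of_le ?_ (measure_mono hsub)
    rw [measure_sdiff_null (P.roots.toFinset.finite_toSet.measure_zero _)]
    simp
  · filter_upwards [ae_restrict_mem measurableSet_Ioo] with x hx
    exact mul_nonneg (hnn x) (jacobi_pos α β hx).le

theorem wFunctional_mul_self_pos {α β : ℝ} (hα : -1 < α) (hβ : -1 < β)
    {P : ℝ[X]} (hP : P ≠ 0) : 0 < wFunctional hα hβ (P * P) :=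
  wFunctional_pos hα hβ (mul_ne_zero hP hP) fun x => by
    rw [eval_mul]; exact mul_self_nonneg _

/-! ### Orthogonal polynomials -/

theorem monicOrth_spec {α β : ℝ} (hα : -1 < α) (hβ : -1 < β)
    (n : ℕ) : (monicOrth α β n).Monic ∧ (monicOrth α β n).natDegree = n ∧
    ∀ k < n, wFunctional hα hβ (monicOrth α β n * monicOrth α β k) = 0 := by
  induction n using Nat.strong_induction_on with
  | _ n ih =>
    rw [monicOrth]
    set c : Fin n → ℝ := fun k => wInner α β (X ^ n) (monicOrth α β k) /
      wInner α β (monicOrth α β k) (monicOrth α β k) with hc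
    have hdeg : (∑ k : Fin n, C (c k) * monicOrth α β k).degree < n := by
      refine (degree_sum_le _ _).trans_lt ((Finset.sup_lt_iff (WithBot.bot_lt_coe n)).2 ?_)
      intro k _
      rw [← smul_eq_C_mul]
      refine (degree_smul_le _ _).trans_lt ?_
      rw [degree_eq_natDegree (ih k k.2).1.ne_zero, (ih k k.2).2.1]
      exact Nat.cast_lt.2 k.2
    refine ⟨monic_X_pow_sub (n := n) hdeg, ?_, ?_⟩
    · refine natDegree_eq_of_degree_eq_some ?_
      rw [degree_sub_eq_left_of_degree_lt (by rwa [degree_X_pow]), degree_X_pow]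
    · intro j hj
      have hne : monicOrth α β j ≠ 0 := (ih j hj).1.ne_zero
      have hpos := wFunctional_mul_self_pos hα hβ hne
      have hother : ∀ k : Fin n, k ≠ ⟨j, hj⟩ →
          wFunctional hα hβ (C (c k) * monicOrth α β k * monicOrth α β j) = 0 := by
        intro k hk
        have hk' : (k : ℕ) ≠ j := fun h => hk (Fin.ext h)
        rw [mul_assoc, wFunctional_C_mul]
        rcases lt_or_gt_of_ne hk' with h | h
        · rw [mul_comm (monicOrth α β k), (ih j hj).2.2 k h, mul_zero]
        · rw [(ih k k.2).2.2 j h, mul_zero]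
      rw [sub_mul, map_sub, Finset.sum_mul, map_sum,
        Finset.sum_eq_single_of_mem ⟨j, hj⟩ (Finset.mem_univ _) fun k _ hk => hother k hk,
        mul_assoc, wFunctional_C_mul, hc]
      simp only [wInner_eq hα hβ]
      rw [div_mul_cancel₀ _ hpos.ne', sub_self]

theorem sqrt_wInner_monicOrth_pos {α β : ℝ} (hα : -1 < α) (hβ : -1 < β) (n : ℕ) :
    0 < Real.sqrt (wInner α β (monicOrth α β n) (monicOrth α β n)) := by
  rw [Real.sqrt_pos, wInner_eq hα hβ]
  exact wFunctional_mul_self_pos hα hβ (monicOrth_spec hα hβ n).1.ne_zero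

theorem orthoPoly_degree {α β : ℝ} (hα : -1 < α) (hβ : -1 < β)
    (n : ℕ) : (orthoPoly α β n).degree = n := by
  rw [orthoPoly, degree_C_mul (inv_ne_zero (sqrt_wInner_monicOrth_pos hα hβ n).ne'),
    degree_eq_natDegree (monicOrth_spec hα hβ n).1.ne_zero, (monicOrth_spec hα hβ n).2.1]

theorem orthoPoly_orthonormal {α β : ℝ} (hα : -1 < α) (hβ : -1 < β) (i j : ℕ) :
    wFunctional hα hβ (orthoPoly α β i * orthoPoly α β j) = if i = j then 1 else 0 := by
  have e : orthoPoly α β i * orthoPoly α β j =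
      C ((Real.sqrt (wInner α β (monicOrth α β i) (monicOrth α β i)))⁻¹ *
        (Real.sqrt (wInner α β (monicOrth α β j) (monicOrth α β j)))⁻¹) *
        (monicOrth α β i * monicOrth α β j) := by
    rw [orthoPoly, orthoPoly, C_mul]; ring
  rw [e, wFunctional_C_mul]
  rcases lt_trichotomy i j with h | rfl | h
  · rw [mul_comm (monicOrth α β i), (monicOrth_spec hα hβ j).2.2 i h, mul_zero, if_neg h.ne]
  · have h0 := sqrt_wInner_monicOrth_pos hα hβ i
    have h1 := Real.mul_self_sqrt (Real.sqrt_pos.1 h0).le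
    rw [if_pos rfl, ← wInner_eq hα hβ, ← mul_inv, h1, inv_mul_cancel₀ (Real.sqrt_pos.1 h0).ne']
  · rw [(monicOrth_spec hα hβ i).2.2 j h, mul_zero, if_neg h.ne']

/-- The orthonormal polynomials as a sequence with one member of each degree. -/
noncomputable def orthoSequence {α β : ℝ} (hα : -1 < α) (hβ : -1 < β) : Polynomial.Sequence ℝ where
  elems' := orthoPoly α β
  degree_eq' := orthoPoly_degree hα hβ

theorem mem_span_orthoPoly {α β : ℝ} (hα : -1 < α) (hβ : -1 < β)
    {n : ℕ} {Q : ℝ[X]} (hQ : Q.degree < n) :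
    Q ∈ Submodule.span ℝ (orthoPoly α β '' Set.Iio n) := by
  have h := (orthoSequence hα hβ).span_degreeLT (m := n) fun i _ =>
    (leadingCoeff_ne_zero.2 ((orthoSequence hα hβ).ne_zero i)).isUnit
  have h1 : Q ∈ degreeLT ℝ n := mem_degreeLT.2 hQ
  rw [← h] at h1
  exact h1

theorem wFunctional_orthoPoly_mul {α β : ℝ} (hα : -1 < α) (hβ : -1 < β)
    {n : ℕ} {Q : ℝ[X]} (hQ : Q.degree < n) :
    wFunctional hα hβ (orthoPoly α β n * Q) = 0 := by
  have hmem := mem_span_orthoPoly hα hβ hQ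
  clear hQ
  induction hmem using Submodule.span_induction with
  | mem x hx =>
    obtain ⟨i, hi, rfl⟩ := hx
    rw [orthoPoly_orthonormal, if_neg (ne_of_gt hi)]
  | zero => simp
  | add x y _ _ h1 h2 => rw [mul_add, map_add, h1, h2, add_zero]
  | smul c x _ h => rw [mul_smul_comm, map_smul, h, smul_zero]

theorem sum_orthoPoly_eq {α β : ℝ} (hα : -1 < α) (hβ : -1 < β)
    {n : ℕ} {Q : ℝ[X]} (hQ : Q.degree < n) :
    ∑ j ∈ Finset.range n, C (wFunctional hα hβ (orthoPoly α β j * Q)) * orthoPoly α β j = Q := by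
  have hmem := mem_span_orthoPoly hα hβ hQ
  clear hQ
  induction hmem using Submodule.span_induction with
  | mem x hx =>
    obtain ⟨i, hi, rfl⟩ := hx
    simp only [orthoPoly_orthonormal]
    rw [Finset.sum_eq_single_of_mem i (Finset.mem_range.2 hi)]
    · simp
    · intro j _ hj
      simp [hj]
  | zero => simp
  | add x y _ _ h1 h2 =>
    simp only [mul_add, map_add, add_mul, Finset.sum_add_distrib, h1, h2]
  | smul c x _ h =>
    simp only [mul_smul_comm, map_smul, smul_eq_mul, C_mul, mul_assoc, ← Finset.mul_sum, h]
    rw [smul_eq_C_mul]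

/-- An orthogonal polynomial has no nonconstant factor that is nonnegative on the line: if
`p_n = g q` with `g ≥ 0`, then `∫ p_n q w = ∫ g q² w > 0` although `q` has smaller degree. -/
theorem natDegree_eq_zero_of_nonneg_factor {α β : ℝ} (hα : -1 < α) (hβ : -1 < β)
    {n : ℕ} {g q : ℝ[X]} (h : orthoPoly α β n = g * q)
    (hg : ∀ x, 0 ≤ g.eval x) : g.natDegree = 0 := by
  by_contra hd
  have hne : orthoPoly α β n ≠ 0 := (orthoSequence hα hβ).ne_zero n
  have hg0 : g ≠ 0 := by rintro rfl; simp at hd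
  have hq0 : q ≠ 0 := by rintro rfl; exact hne (by rw [h, mul_zero])
  have hdeg : g.natDegree + q.natDegree = n := by
    rw [← natDegree_mul hg0 hq0, ← h]
    exact natDegree_eq_of_degree_eq_some (orthoPoly_degree hα hβ n)
  have hq : q.degree < n := by
    rw [degree_eq_natDegree hq0]
    exact_mod_cast (by omega : q.natDegree < n)
  have h1 := wFunctional_orthoPoly_mul hα hβ hq
  have h2 : 0 < wFunctional hα hβ (orthoPoly α β n * q) := by
    rw [h, mul_assoc]
    refine wFunctional_pos hα hβ (mul_ne_zero hg0 (mul_ne_zero hq0 hq0)) fun x => ?_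
    rw [eval_mul, eval_mul]
    exact mul_nonneg (hg x) (mul_self_nonneg _)
  exact h2.ne' h1

/-- The polynomial `p_n` has `n` distinct real zeros. -/
theorem card_nodes {α β : ℝ} (hα : -1 < α) (hβ : -1 < β) (n : ℕ) : (nodes α β n).card = n := by
  have hne : orthoPoly α β n ≠ 0 := (orthoSequence hα hβ).ne_zero n
  have hnodup : (orthoPoly α β n).roots.Nodup := by
    rw [Multiset.nodup_iff_count_le_one]
    intro a
    rw [count_roots]
    by_contra hlt
    obtain ⟨q, hq⟩ := (le_rootMultiplicity_iff hne).1 (not_le.1 hlt)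
    have := natDegree_eq_zero_of_nonneg_factor hα hβ hq fun x => by
      rw [eval_pow]; exact even_two.pow_nonneg _
    rw [natDegree_pow, natDegree_X_sub_C] at this
    omega
  obtain ⟨q, hq, hcard, hroots⟩ := exists_prod_multiset_X_sub_C_mul (orthoPoly α β n)
  have hq0 : q ≠ 0 := by rintro rfl; exact hne (by rw [← hq, mul_zero])
  have hnoroot : ∀ x, q.eval x ≠ 0 := by
    intro x hx
    have : x ∈ q.roots := (mem_roots hq0).2 hx
    rw [hroots] at this
    simp at this
  have hsign : (∀ x, 0 ≤ q.eval x) ∨ ∀ x, q.eval x ≤ 0 := by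
    by_contra hcon
    push Not at hcon
    obtain ⟨⟨x, hx⟩, y, hy⟩ := hcon
    obtain ⟨z, hz⟩ := mem_range_of_exists_le_of_exists_ge q.continuous ⟨x, hx.le⟩ ⟨y, hy.le⟩
    exact hnoroot z hz
  have hqd : q.natDegree = 0 := by
    rcases hsign with hs | hs
    · exact natDegree_eq_zero_of_nonneg_factor hα hβ (g := q)
        (by rw [mul_comm]; exact hq.symm) hs
    · have := natDegree_eq_zero_of_nonneg_factor hα hβ (n := n) (g := -q)
        (q := -((orthoPoly α β n).roots.map fun a => X - C a).prod)
        (by rw [neg_mul_neg, mul_comm]; exact hq.symm) fun x => by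
          rw [eval_neg]; linarith [hs x]
      rwa [natDegree_neg] at this
  rw [hqd, add_zero, natDegree_eq_of_degree_eq_some (orthoPoly_degree hα hβ n)] at hcard
  rw [nodes, Multiset.toFinset_card_of_nodup hnodup, hcard]

/-! ### Gauss quadrature and reproduction of polynomials -/

theorem eval_monicOrth_of_mem_nodes {α β : ℝ} (hα : -1 < α) (hβ : -1 < β)
    {n : ℕ} {y : ℝ} (hy : y ∈ nodes α β n) :
    (monicOrth α β n).eval y = 0 := by
  have hne : orthoPoly α β n ≠ 0 := (orthoSequence hα hβ).ne_zero n
  have h1 : (orthoPoly α β n).eval y = 0 := by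
    rw [nodes, Multiset.mem_toFinset, mem_roots hne] at hy
    exact hy
  rw [orthoPoly, eval_mul, eval_C, mul_eq_zero] at h1
  exact h1.resolve_left (inv_ne_zero (sqrt_wInner_monicOrth_pos hα hβ n).ne')

theorem wFunctional_monicOrth_mul {α β : ℝ} (hα : -1 < α) (hβ : -1 < β)
    {n : ℕ} {Q : ℝ[X]} (hQ : Q.degree < n) :
    wFunctional hα hβ (monicOrth α β n * Q) = 0 := by
  have h := wFunctional_orthoPoly_mul hα hβ hQ
  rw [orthoPoly, mul_assoc, wFunctional_C_mul, mul_eq_zero] at h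
  exact h.resolve_left (inv_ne_zero (sqrt_wInner_monicOrth_pos hα hβ n).ne')

/-- The interpolatory quadrature at the zeros of `p_n` is exact for degrees below `2n`. -/
theorem wFunctional_eq_sum_basis {α β : ℝ} (hα : -1 < α) (hβ : -1 < β)
    {n : ℕ} {R : ℝ[X]} (hR : R.natDegree < 2 * n) :
    wFunctional hα hβ R = ∑ y ∈ nodes α β n,
      R.eval y * wFunctional hα hβ (Lagrange.basis (nodes α β n) id y) := by
  obtain ⟨hmonic, hnat, -⟩ := monicOrth_spec hα hβ n
  set p := monicOrth α β n with hp
  have hdiv := modByMonic_add_div R p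
  have h1 : wFunctional hα hβ (p * (R /ₘ p)) = 0 := by
    refine wFunctional_monicOrth_mul hα hβ (degree_le_natDegree.trans_lt ?_)
    rw [natDegree_divByMonic R hmonic, hnat]
    exact_mod_cast (by omega : R.natDegree - n < n)
  have hdeg : (R %ₘ p).degree < (nodes α β n).card := by
    rw [card_nodes hα hβ]
    refine (degree_modByMonic_lt R hmonic).trans_eq ?_
    rw [degree_eq_natDegree hmonic.ne_zero, hnat]
  have heval : ∀ y ∈ nodes α β n, (R %ₘ p).eval y = R.eval y := by
    intro y hy
    conv_rhs => rw [← hdiv]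
    rw [eval_add, eval_mul, eval_monicOrth_of_mem_nodes hα hβ hy, zero_mul, add_zero]
  have h2 := Lagrange.eq_interpolate (s := nodes α β n) (v := id) (injOn_id _) hdeg
  conv_lhs => rw [← hdiv, map_add, h1, add_zero, h2, Lagrange.interpolate_apply, map_sum]
  refine Finset.sum_congr rfl fun y hy => ?_
  rw [wFunctional_C_mul, id, heval y hy]

/-- The Christoffel numbers are the weights of the interpolatory quadrature: apply it to `K ℓ_y`,
where `ℓ_y` is the Lagrange basis polynomial and `K = ∑_{j<n} p_j(y) p_j` is the reproducing
kernel at the node `y`. -/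
theorem wFunctional_basis {α β : ℝ} (hα : -1 < α) (hβ : -1 < β)
    {n : ℕ} {y : ℝ} (hy : y ∈ nodes α β n) :
    wFunctional hα hβ (Lagrange.basis (nodes α β n) id y) = christoffel α β n y := by
  have hcard := card_nodes hα hβ n
  have hn : 0 < n := by rw [← hcard]; exact Finset.card_pos.2 ⟨y, hy⟩
  set ℓ := Lagrange.basis (nodes α β n) id y with hℓ
  set K : ℝ[X] := ∑ j ∈ Finset.range n, C ((orthoPoly α β j).eval y) * orthoPoly α β j with hK
  have hℓdeg : ℓ.natDegree = n - 1 := by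
    rw [hℓ, Lagrange.natDegree_basis (injOn_id _) hy, hcard]
  have hℓy : ℓ.eval y = 1 := Lagrange.eval_basis_self (v := id) (injOn_id _) hy
  have hKdeg : K.natDegree ≤ n - 1 := by
    refine natDegree_sum_le_of_forall_le _ _ fun j hj => (natDegree_C_mul_le _ _).trans ?_
    rw [natDegree_eq_of_degree_eq_some (orthoPoly_degree hα hβ j)]
    have := Finset.mem_range.1 hj
    omega
  have h1 : wFunctional hα hβ (K * ℓ) = 1 := by
    have h2 := sum_orthoPoly_eq hα hβ (n := n) (Q := ℓ) (degree_le_natDegree.trans_lt (by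
      rw [hℓdeg]; exact_mod_cast (by omega : n - 1 < n)))
    have h3 := congrArg (eval y) h2
    rw [hℓy, eval_finsetSum] at h3
    rw [← h3, hK, Finset.sum_mul, map_sum]
    refine Finset.sum_congr rfl fun j _ => ?_
    rw [mul_assoc, wFunctional_C_mul, eval_mul, eval_C, mul_comm]
  have h4 : wFunctional hα hβ (K * ℓ) = K.eval y * wFunctional hα hβ ℓ := by
    rw [wFunctional_eq_sum_basis hα hβ (n := n) (natDegree_mul_le.trans_lt (by omega)),
      Finset.sum_eq_single_of_mem y hy]
    · rw [eval_mul, hℓy, mul_one]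
    · intro z hz hzy
      have : ℓ.eval z = 0 := Lagrange.eval_basis_of_ne (v := id) hzy.symm hz
      rw [eval_mul, this, mul_zero, zero_mul]
  have h5 : K.eval y = ∑ j ∈ Finset.range n, (orthoPoly α β j).eval y ^ 2 := by
    rw [hK, eval_finsetSum]
    refine Finset.sum_congr rfl fun j _ => ?_
    rw [eval_mul, eval_C, sq]
  rw [h4] at h1
  rw [christoffel, ← h5]
  exact eq_inv_of_mul_eq_one_right h1

/-- Gauss quadrature. -/
theorem wFunctional_eq_sum_christoffel {α β : ℝ} (hα : -1 < α) (hβ : -1 < β)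
    {n : ℕ} {R : ℝ[X]} (hR : R.natDegree < 2 * n) :
    wFunctional hα hβ R = ∑ y ∈ nodes α β n, christoffel α β n y * R.eval y := by
  rw [wFunctional_eq_sum_basis hα hβ hR]
  refine Finset.sum_congr rfl fun y hy => ?_
  rw [wFunctional_basis hα hβ hy, mul_comm]

/-- The filtered de la Vallée Poussin operator reproduces polynomials of degree at most `n - m`. -/
theorem vp_polynomial {α β : ℝ} (hα : -1 < α) (hβ : -1 < β)
    {n m : ℕ} (hm : 0 < m) {P : ℝ[X]} (hP : P.natDegree + m ≤ n) :
    vp α β n m (fun x => P.eval x) = P := by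
  have hdeg : ∀ j, (orthoPoly α β j).natDegree = j := fun j =>
    natDegree_eq_of_degree_eq_some (orthoPoly_degree hα hβ j)
  have h1 : vp α β n m (fun x => P.eval x) = ∑ j ∈ Finset.range (n + m),
      C (vpFilter n m j * wFunctional hα hβ (orthoPoly α β j * P)) * orthoPoly α β j := by
    simp only [vp, vpFundamental, Finset.mul_sum]
    rw [Finset.sum_comm]
    refine Finset.sum_congr rfl fun j hj => ?_
    have hj' := Finset.mem_range.1 hj
    rw [wFunctional_eq_sum_christoffel hα hβ (n := n) (natDegree_mul_le.trans_lt (by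
      rw [hdeg]; omega)), Finset.mul_sum, map_sum, Finset.sum_mul]
    refine Finset.sum_congr rfl fun y _ => ?_
    simp only [eval_mul, C_mul]
    ring
  have h2 : ∀ j, P.natDegree < j → wFunctional hα hβ (orthoPoly α β j * P) = 0 := fun j hj =>
    wFunctional_orthoPoly_mul hα hβ (degree_le_natDegree.trans_lt (by exact_mod_cast hj))
  rw [h1]
  conv_rhs => rw [← sum_orthoPoly_eq hα hβ (n := n + m) (Q := P) (degree_le_natDegree.trans_lt (by
    exact_mod_cast (by omega : P.natDegree < n + m)))]
  refine Finset.sum_congr rfl fun j _ => ?_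
  by_cases hj : j + m ≤ n
  · rw [vpFilter, if_pos hj, one_mul]
  · rw [h2 j (by omega), mul_zero]

theorem natDegree_vp_le {α β : ℝ} (hα : -1 < α) (hβ : -1 < β)
    (n m : ℕ) (f : ℝ → ℝ) : (vp α β n m f).natDegree ≤ n + m := by
  refine natDegree_sum_le_of_forall_le _ _ fun y _ => (natDegree_C_mul_le _ _).trans
    ((natDegree_C_mul_le _ _).trans ?_)
  refine natDegree_sum_le_of_forall_le _ _ fun j hj => (natDegree_C_mul_le _ _).trans ?_
  rw [natDegree_eq_of_degree_eq_some (orthoPoly_degree hα hβ j)]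
  exact (Finset.mem_range.1 hj).le

theorem vp_sub (α β : ℝ) (n m : ℕ) (f g : ℝ → ℝ) :
    vp α β n m (fun x => f x - g x) = vp α β n m f - vp α β n m g := by
  simp only [vp, C_sub, sub_mul, Finset.sum_sub_distrib]

/-! ### Polynomials in `B₀` -/

theorem continuous_jacobi {γ δ : ℝ} (hγ : 0 ≤ γ) (hδ : 0 ≤ δ) : Continuous (jacobi γ δ) :=
  (Continuous.rpow_const (by fun_prop) fun _ => Or.inr hγ).mul
    (Continuous.rpow_const (by fun_prop) fun _ => Or.inr hδ)

theorem memC0_polynomial {γ δ : ℝ} (hγ : 0 ≤ γ) (hδ : 0 ≤ δ) (P : ℝ[X]) :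
    MemC0 γ δ (fun x => P.eval x) := by
  have hc : Continuous fun x => P.eval x * jacobi γ δ x :=
    P.continuous.mul (continuous_jacobi hγ hδ)
  refine ⟨P.continuous.continuousOn, ⟨_, hc.continuousWithinAt.tendsto, fun h => ?_⟩,
    ⟨_, hc.continuousWithinAt.tendsto, fun h => ?_⟩⟩
  · simp [jacobi, Real.zero_rpow h.ne']
  · simp [jacobi, Real.zero_rpow h.ne']

theorem MemC0.sub {γ δ : ℝ} {f g : ℝ → ℝ} (hf : MemC0 γ δ f) (hg : MemC0 γ δ g) :
    MemC0 γ δ (fun x => f x - g x) := by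
  obtain ⟨hf1, ⟨l, hl, hl0⟩, ⟨l', hl', hl0'⟩⟩ := hf
  obtain ⟨hg1, ⟨k, hk, hk0⟩, ⟨k', hk', hk0'⟩⟩ := hg
  refine ⟨hf1.sub hg1, ⟨l - k, ?_, fun h => by rw [hl0 h, hk0 h, sub_zero]⟩,
    ⟨l' - k', ?_, fun h => by rw [hl0' h, hk0' h, sub_zero]⟩⟩
  · simpa only [sub_mul] using hl.sub hk
  · simpa only [sub_mul] using hl'.sub hk'

theorem bestApprox_sub_polynomial_le (γ δ : ℝ) (f : ℝ → ℝ) {P : ℝ[X]} {n : ℕ}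
    (hP : P.natDegree ≤ n) :
    bestApprox γ δ n (fun x => f x - P.eval x) ≤ bestApprox γ δ n f := by
  refine le_iInf₂ fun R hR => ?_
  refine (bestApprox_le _ (P := R - P) ((natDegree_sub_le _ _).trans (max_le hR hP))).trans_eq ?_
  congr 1
  ext x
  rw [eval_sub]
  ring

theorem MemB0.sub_polynomial {γ δ : ℝ} (hγ : 0 ≤ γ) (hδ : 0 ≤ δ) {f : ℝ → ℝ}
    (hf : MemB0 γ δ f) (P : ℝ[X]) : MemB0 γ δ (fun x => f x - P.eval x) := by
  have hC0 := hf.1.sub (memC0_polynomial hγ hδ P)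
  refine ⟨hC0, ?_⟩
  set W := wSupNorm γ δ (fun x => f x - P.eval x) with hW
  have hterm : ∀ n : ℕ, bestApprox γ δ (n + 1) (fun x => f x - P.eval x) / ((n : ℝ≥0∞) + 2) ≤
      bestApprox γ δ (n + 1) f / ((n : ℝ≥0∞) + 2) + if n < P.natDegree then W else 0 := by
    intro n
    by_cases hn : n < P.natDegree
    · rw [if_pos hn]
      refine le_add_left (ENNReal.div_le_of_le_mul ?_)
      refine (bestApprox_le_wSupNorm γ δ _ _).trans (le_mul_of_one_le_right' ?_)
      exact le_add_left (by norm_num)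
    · rw [if_neg hn, add_zero]
      gcongr
      exact bestApprox_sub_polynomial_le γ δ f (by omega)
  refine (ENNReal.tsum_le_tsum hterm).trans_lt ?_
  rw [ENNReal.tsum_add]
  refine ENNReal.add_lt_top.2 ⟨hf.2, ?_⟩
  rw [tsum_eq_sum (s := Finset.range P.natDegree) fun n hn => if_neg (by simpa using hn)]
  refine ENNReal.sum_lt_top.2 fun n _ => ?_
  split_ifs
  · exact hC0.wSupNorm_ne_top.lt_top
  · simp

theorem memB0_polynomial {γ δ : ℝ} (hγ : 0 ≤ γ) (hδ : 0 ≤ δ) (P : ℝ[X]) :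
    MemB0 γ δ (fun x => P.eval x) := by
  have h0 : MemB0 γ δ (fun _ => 0) := by
    refine ⟨by simpa using memC0_polynomial hγ hδ (0 : ℝ[X]), ?_⟩
    have h1 : wSupNorm γ δ (fun _ => 0) = 0 := by simp [wSupNorm]
    have h2 : ∀ n, bestApprox γ δ n (fun _ => 0) = 0 := fun n =>
      le_antisymm ((bestApprox_le_wSupNorm γ δ n _).trans_eq h1) zero_le
    simp [besovSum, h2]
  simpa using h0.sub_polynomial hγ hδ (-P)

/-! ### Uniformly bounded de la Vallée Poussin operators -/

theorem tendsto_bestApprox {γ δ : ℝ} {f : ℝ → ℝ} (hf : MemB0 γ δ f) :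
    Tendsto (fun n => bestApprox γ δ n f) atTop (𝓝 0) := by
  have hfin : ∑' j : ℕ, 2 ^ j * bestApprox γ δ (2 ^ 2 ^ j) f ≠ ∞ := by
    refine ne_top_of_le_ne_top ?_ (tsum_two_pow_mul_bestApprox_le γ δ f)
    exact ENNReal.add_ne_top.2 ⟨ENNReal.mul_ne_top (by simp) hf.1.wSupNorm_ne_top,
      ENNReal.mul_ne_top (by simp) hf.2.ne⟩
  have hsub : Tendsto (fun j : ℕ => 2 ^ 2 ^ j) atTop (atTop : Filter ℕ) :=
    (tendsto_pow_atTop_atTop_of_one_lt one_lt_two).comp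
      (tendsto_pow_atTop_atTop_of_one_lt one_lt_two)
  have hzero : Tendsto (fun j : ℕ => bestApprox γ δ (2 ^ 2 ^ j) f) atTop (𝓝 0) := by
    refine tendsto_of_tendsto_of_tendsto_of_le_of_le tendsto_const_nhds
      (ENNReal.tendsto_atTop_zero_of_tsum_ne_top hfin) (fun _ => zero_le) fun j => ?_
    exact le_mul_of_one_le_left' (one_le_pow₀ (by norm_num))
  have hlim := tendsto_atTop_iInf (bestApprox_antitone γ δ f)
  rwa [tendsto_nhds_unique (hlim.comp hsub) hzero] at hlim

/-- Every `E_i` occurs `q` times in the sum, with weights at most `1 / (i + 1)`. -/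
theorem tsum_bestApprox_div_ne_top {γ δ : ℝ} {f : ℝ → ℝ} (hf : MemB0 γ δ f) (q : ℕ) [NeZero q] :
    ∑' n : ℕ, bestApprox γ δ (n / q) f / ((n : ℝ≥0∞) + 1) ≠ ∞ := by
  have h1 : ∑' n : ℕ, bestApprox γ δ (n / q) f / ((n : ℝ≥0∞) + 1) ≤
      ∑' n : ℕ, bestApprox γ δ (n / q) f / (((n / q : ℕ) : ℝ≥0∞) + 1) := by
    refine ENNReal.tsum_le_tsum fun n => ?_
    gcongr
    exact Nat.div_le_self n q
  have h2 : ∑' n : ℕ, bestApprox γ δ (n / q) f / (((n / q : ℕ) : ℝ≥0∞) + 1) =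
      q * (bestApprox γ δ 0 f + besovSum γ δ f) := by
    rw [← tsum_bestApprox_div, ← ENNReal.tsum_mul_left]
    have h3 := (Nat.divModEquiv q).tsum_eq
      fun p : ℕ × Fin q => bestApprox γ δ p.1 f / ((p.1 : ℝ≥0∞) + 1)
    rw [ENNReal.tsum_prod (f := fun (i : ℕ) (_ : Fin q) => bestApprox γ δ i f / ((i : ℝ≥0∞) + 1))]
      at h3
    simpa using h3
  refine ne_top_of_le_ne_top ?_ (h1.trans_eq h2)
  refine ENNReal.mul_ne_top (by simp) (ENNReal.add_ne_top.2 ⟨?_, hf.2.ne⟩)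
  exact ne_top_of_le_ne_top hf.1.wSupNorm_ne_top (bestApprox_le_wSupNorm γ δ 0 f)

/-- A majorant of the `B₀` norm of `f - V_n^m f` that tends to `0` as `L → ∞`, by dominated
convergence. -/
theorem tendsto_tsum_bestApprox_max {γ δ : ℝ} {f : ℝ → ℝ} (hf : MemB0 γ δ f) (q : ℕ) [NeZero q] :
    Tendsto (fun L : ℕ => bestApprox γ δ L f +
      ∑' j : ℕ, bestApprox γ δ (max L ((j + 1) / q)) f / ((j : ℝ≥0∞) + 2)) atTop (𝓝 0) := by
  have hE := tendsto_bestApprox hf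
  have hdom : ∑' j : ℕ, bestApprox γ δ ((j + 1) / q) f / ((j : ℝ≥0∞) + 2) ≠ ∞ := by
    refine ne_top_of_le_ne_top (tsum_bestApprox_div_ne_top hf q) ?_
    refine le_trans (le_of_eq ?_) (ENNReal.tsum_comp_le_tsum_of_injective
      (add_left_injective 1) fun n : ℕ => bestApprox γ δ (n / q) f / ((n : ℝ≥0∞) + 1))
    refine tsum_congr fun j => ?_
    congr 1
    push_cast
    rw [add_assoc, one_add_one_eq_two]
  have hT : Tendsto (fun L : ℕ =>
      ∑' j : ℕ, bestApprox γ δ (max L ((j + 1) / q)) f / ((j : ℝ≥0∞) + 2)) atTop (𝓝 0) := by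
    simp only [← lintegral_count]
    rw [← lintegral_count] at hdom
    have := tendsto_lintegral_of_dominated_convergence (μ := Measure.count)
      (F := fun (L : ℕ) (j : ℕ) =>
        bestApprox γ δ (max L ((j + 1) / q)) f / ((j : ℝ≥0∞) + 2)) (f := fun _ => 0)
      (fun j : ℕ => bestApprox γ δ ((j + 1) / q) f / ((j : ℝ≥0∞) + 2))
      (fun L => measurable_of_countable _) (fun L => Eventually.of_forall fun j => ?_) hdom
      (Eventually.of_forall fun j => ?_)
    · simpa using this
    · exact ENNReal.div_le_div_right (bestApprox_antitone γ δ f (le_max_right _ _)) _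
    · refine tendsto_of_tendsto_of_tendsto_of_le_of_le tendsto_const_nhds hE (fun _ => zero_le)
        fun L => ?_
      refine (ENNReal.div_le_of_le_mul ?_)
      refine (bestApprox_antitone γ δ f (le_max_left L _)).trans (le_mul_of_one_le_right' ?_)
      exact le_add_left (by norm_num)
  simpa using hE.add hT

/-- A bounded operator `V_n^m` is quasi-optimal, since it reproduces polynomials of degree
`n - m`. -/
theorem wSupNorm_sub_vp_le {α β γ δ : ℝ} (hα : -1 < α) (hβ : -1 < β) (hγ : 0 ≤ γ) (hδ : 0 ≤ δ)
    {n m L : ℕ} (hm : 0 < m) (hL : L + m ≤ n) {K : ℝ≥0∞} (hK : K ≠ ∞)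
    (hV : ∀ g : ℝ → ℝ, MemC0 γ δ g →
      wSupNorm γ δ (fun x => (vp α β n m g).eval x) ≤ K * wSupNorm γ δ g)
    {f : ℝ → ℝ} (hf : MemC0 γ δ f) :
    wSupNorm γ δ (fun x => f x - (vp α β n m f).eval x) ≤ (1 + K) * bestApprox γ δ L f := by
  have h1 : (1 + K) ≠ 0 := by simp
  have h2 : (1 + K) ≠ ∞ := by simpa using hK
  rw [← ENNReal.div_le_iff' h1 h2]
  refine le_iInf₂ fun P hP => ?_
  rw [ENNReal.div_le_iff' h1 h2]
  set g : ℝ → ℝ := fun x => f x - P.eval x with hg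
  have hgC : MemC0 γ δ g := hf.sub (memC0_polynomial hγ hδ P)
  have e : ∀ x, f x - (vp α β n m f).eval x = g x - (vp α β n m g).eval x := by
    intro x
    rw [hg, vp_sub α β n m f (fun x => P.eval x), vp_polynomial hα hβ hm (by omega), eval_sub]
    ring
  simp only [e]
  have h3 := wSupNorm_sub_le γ δ g (fun x => (vp α β n m g).eval x) (fun _ => 0)
  have h4 : ∀ k : ℝ → ℝ, wSupNorm γ δ (fun x => 0 - k x) = wSupNorm γ δ k := by
    intro k
    simp [wSupNorm]
  rw [h4, h4] at h3
  calc _ ≤ _ := h3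
    _ ≤ K * wSupNorm γ δ g + wSupNorm γ δ g := by gcongr; exact hV g hgC
    _ = _ := by ring

/-- The bound of `f - V_n^m f` in `B₀`. For `j < n + m` the error `E_j(f - V_n^m f)` is controlled
by quasi-optimality and for `j ≥ n + m` it equals `E_j(f)`. As `n - m` is comparable to `n + m`,
both cases are covered by `E_{max(L, j / q)}(f)`. -/
theorem norm_sub_vp_le {α β γ δ : ℝ} (hα : -1 < α) (hβ : -1 < β) (hγ : 0 ≤ γ) (hδ : 0 ≤ δ)
    {n m L q : ℕ} (hm : 0 < m) (hmn : m < n) (hq : n + m ≤ q * (n - m)) (hL : q * L ≤ n)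
    {K : ℝ≥0∞} (hK : K ≠ ∞)
    (hV : ∀ g : ℝ → ℝ, MemC0 γ δ g →
      wSupNorm γ δ (fun x => (vp α β n m g).eval x) ≤ K * wSupNorm γ δ g)
    {f : ℝ → ℝ} (hf : MemC0 γ δ f) :
    wSupNorm γ δ (fun x => f x - (vp α β n m f).eval x) +
        besovSum γ δ (fun x => f x - (vp α β n m f).eval x) ≤
      (1 + K) * (bestApprox γ δ L f +
        ∑' j : ℕ, bestApprox γ δ (max L ((j + 1) / q)) f / ((j : ℝ≥0∞) + 2)) := by
  have hq0 : 0 < q := by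
    rcases Nat.eq_zero_or_pos q with rfl | h
    · omega
    · exact h
  have hLle : L ≤ n - m := by
    by_contra h
    have : q * (n - m) < q * L := Nat.mul_lt_mul_of_pos_left (by omega) hq0
    omega
  have hLn : L ≤ n := by omega
  rw [mul_add]
  refine add_le_add (wSupNorm_sub_vp_le hα hβ hγ hδ hm (by omega) hK hV hf) ?_
  rw [besovSum, ← ENNReal.tsum_mul_left]
  refine ENNReal.tsum_le_tsum fun j => ?_
  rw [← mul_div_assoc]
  refine ENNReal.div_le_div_right ?_ _
  rcases lt_or_ge (j + 1) (n + m) with hj | hj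
  · refine (bestApprox_le_wSupNorm γ δ _ _).trans
      (wSupNorm_sub_vp_le hα hβ hγ hδ hm ?_ hK hV hf)
    have : (j + 1) / q ≤ n - m := Nat.div_le_of_le_mul (by omega)
    have := max_le hLle this
    omega
  · refine (bestApprox_sub_polynomial_le γ δ f ((natDegree_vp_le hα hβ n m f).trans hj)).trans ?_
    refine (bestApprox_antitone γ δ f (max_le (by omega : L ≤ j + 1)
      (Nat.div_le_self (j + 1) q))).trans ?_
    exact le_mul_of_one_le_left' (le_add_right le_rfl)

/-- For `m ≈ n` the numbers `n + m` and `n - m` are comparable. -/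
theorem exists_comparable_bound {c₁ : ℝ} (hc : 1 < c₁) : ∃ q : ℕ, 0 < q ∧
    ∀ n m : ℕ, 0 < m → c₁ * m ≤ n → m < n ∧ n + m ≤ q * (n - m) := by
  obtain ⟨q, hq⟩ := exists_nat_ge (2 * c₁ / (c₁ - 1))
  have hc1 : 0 < c₁ - 1 := by linarith
  have hqpos : (0 : ℝ) < q := lt_of_lt_of_le (by positivity) hq
  rw [div_le_iff₀ hc1] at hq
  refine ⟨q, by exact_mod_cast hqpos, fun n m hm hmn => ?_⟩
  have hm0 : (0 : ℝ) < m := by exact_mod_cast hm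
  have hlt : (m : ℝ) < n := by nlinarith
  have hlt' : m < n := by exact_mod_cast hlt
  refine ⟨hlt', ?_⟩
  have h1 : c₁ * (2 * n) ≤ c₁ * (q * (n - m)) := by
    have h2 : (c₁ - 1) * n ≤ c₁ * ((n : ℝ) - m) := by linarith
    have h3 := mul_le_mul_of_nonneg_left h2 hqpos.le
    have h4 := mul_le_mul_of_nonneg_right hq (by linarith : (0 : ℝ) ≤ n)
    nlinarith
  have h5 : (2 : ℝ) * n ≤ q * (n - m) := le_of_mul_le_mul_left h1 (by linarith)
  have h6 : ((n + m : ℕ) : ℝ) ≤ ((q * (n - m) : ℕ) : ℝ) := by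
    push_cast [Nat.cast_sub hlt'.le]
    linarith
  exact_mod_cast h6

end VPHilbert

open VPHilbert
theorem theorem4p2 (a b α β : ℝ) (ha : -1 < a) (hb : -1 < b) (hα : -1 < α) (hβ : -1 < β) :
    (∃ K : ℝ, 0 < K ∧ ∀ f : ℝ → ℝ, MemB0 (plusPart a) (plusPart b) f →
      ∀ n m : ℕ, 0 < m → m < n →
        MemB0 (plusPart a) (plusPart b) (fun x => f x - (vp α β n m f).eval x) ∧
        ∀ t ∈ Set.Ioo (-1 : ℝ) 1,
          HilbertExists a b f t ∧
          HilbertExists a b (fun x => (vp α β n m f).eval x) t ∧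
          vpError a b α β n m f t * u₂ a b t ≤
            K * (|f t - (vp α β n m f).eval t| * u₁ a b t) +
            K * normB0 (plusPart a) (plusPart b) (fun x => f x - (vp α β n m f).eval x)) ∧
    (∀ c₁ c₂ : ℝ, 1 < c₁ → c₁ ≤ c₂ →
      VPUniformlyBounded α β (plusPart a) (plusPart b) c₁ c₂ →
      ∀ f : ℝ → ℝ, MemB0 (plusPart a) (plusPart b) f →
        ∀ ε : ℝ, 0 < ε → ∃ N : ℕ, ∀ n m : ℕ, N ≤ n → Comparable c₁ c₂ n m →
          ∀ t ∈ Set.Ioo (-1 : ℝ) 1, vpError a b α β n m f t * u₂ a b t < ε) := by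
  have hA := plusPart_nonneg a
  have hB := plusPart_nonneg b
  obtain ⟨K, hK, h⟩ := exists_hilbert_le ha hb
  have herr : ∀ f : ℝ → ℝ, MemB0 (plusPart a) (plusPart b) f → ∀ n m : ℕ,
      ∀ t ∈ Set.Ioo (-1 : ℝ) 1, vpError a b α β n m f t * u₂ a b t ≤
        K * normB0 (plusPart a) (plusPart b) (fun x => f x - (vp α β n m f).eval x) := by
    intro f hf n m t ht
    rw [vpError, vpRule, ← hilbert_sub (h f hf t ht).1 (h _ (memB0_polynomial hA hB _) t ht).1]
    exact (h _ (hf.sub_polynomial hA hB _) t ht).2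
  constructor
  · refine ⟨K, hK, fun f hf n m _ _ => ⟨hf.sub_polynomial hA hB _, fun t ht =>
      ⟨(h f hf t ht).1, (h _ (memB0_polynomial hA hB _) t ht).1, ?_⟩⟩⟩
    refine (herr f hf n m t ht).trans (le_add_of_nonneg_left ?_)
    have : 0 ≤ u₁ a b t := (jacobi_pos _ _ ht).le
    positivity
  · intro c₁ c₂ hc₁ _ hV f hf ε hε
    obtain ⟨C, hC, hVC⟩ := hV
    obtain ⟨q, hq0, hq⟩ := exists_comparable_bound hc₁
    have : NeZero q := ⟨hq0.ne'⟩
    have hlim := ENNReal.Tendsto.const_mul (a := 1 + ENNReal.ofReal C)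
      (tendsto_tsum_bestApprox_max hf q) (Or.inr (by simp))
    rw [mul_zero] at hlim
    obtain ⟨L, hL⟩ := (hlim.eventually_lt_const
      (ENNReal.ofReal_pos.2 (div_pos hε hK))).exists
    refine ⟨q * L, fun n m hn hnm t ht => ?_⟩
    obtain ⟨hm, hnm1, -⟩ := id hnm
    obtain ⟨hmn, hqn⟩ := hq n m hm hnm1
    have h1 := (norm_sub_vp_le hα hβ hA hB hm hmn hqn hn ENNReal.ofReal_ne_top
      (fun g hg => hVC n m hnm g hg) hf.1).trans_lt hL
    have h2 : normB0 (plusPart a) (plusPart b) (fun x => f x - (vp α β n m f).eval x) < ε / K := by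
      rw [normB0]
      exact (ENNReal.lt_ofReal_iff_toReal_lt (h1.trans ENNReal.ofReal_lt_top).ne).1 h1
    refine (herr f hf n m t ht).trans_lt ?_
    rwa [lt_div_iff₀' hK] at h2
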